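/- Let $\Gamma$ be a finite group. For a (nonarchimedean) local field $K$, let $q_K$ be the cardinality of its residue field, $G_K=\mathrm{Gal}(K^{\mathrm{sep}}/K)$ its absolute Galois group, $I_K\subseteq G_K$ the inertia subgroup, and $S_{K,\Gamma}$ the set of continuous homomorphisms $G_K\to\Gamma$ (with the discrete topology on $\Gamma$). A counting function for $\Gamma$ is a function $c\colon \bigcup_K S_{K,\Gamma}\to\mathbb{Z}_{\ge 0}$ (the union being over all isomorphism classes of local fields) such that $c(\gamma\rho\gamma^{-1})=c(\rho)$ for all $\gamma\in\Gamma$. It is proper if $c(\rho)=c(\rho')$ for all $\rho\colon G_K\to\Gamma$ and $\rho'\colon G_{K'}\to\Gamma$ such that $q_K$ and $q_{K'}$ are relatively prime to $|\Gamma|$ and $\rho(I_K)=\rho'(I_{K'})$. Let $c$ be a proper counting function for $\Gamma$, and let $a$ be an invertible residue class modulo $|\Gamma|$. Then $(\Gamma,c)$ has a mass formula for all local fields $K$ with $q_K\in a$; that is, there is a polynomial $f(x)\in\mathbb{Z}[x]$ such that for every local field $K$ with $q_K\in a$, the total mass $$M(K,\Gamma,c):=\sum_{\rho\in S_{K,\Gamma}}\frac{1}{q_K^{c(\rho)}}$$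 is finite and equal to $f(1/q_K)$. -/

import Mathlib

open scoped ENNReal ValuativeRel Polynomial

universe u v

noncomputable section

/-- A (nonarchimedean) local field: a nondiscrete locally compact topological field whose topology
is given by a nonarchimedean valuation. -/
structure LocalField : Type (u + 1) where
  carrier : Type u
  [field : Field carrier]
  [valuativeRel : ValuativeRel carrier]
  [topology : TopologicalSpace carrier]
  [isLocalField : IsNonarchimedeanLocalField carrier]

namespace LocalField

instance : CoeSort LocalField.{u} (Type u) := ⟨LocalField.carrier⟩

attribute [instance] LocalField.field LocalField.valuativeRel LocalField.topology
  LocalField.isLocalField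

/-- The cardinality `q_K` of the residue field of `K`. -/
def q (K : LocalField) : ℕ := Nat.card 𝓀[K]

/-- The separable closure `K^sep`. -/
abbrev Sep (K : LocalField) : Type _ := SeparableClosure K

/-- The absolute Galois group `G_K = Gal(K^sep/K)`, with the Krull topology. -/
abbrev absGal (K : LocalField) : Type _ := K.Sep ≃ₐ[K] K.Sep

/-- The ring of integers of `K^sep`, i.e. the integral closure in `K^sep` of the ring of integers
of `K`. -/
abbrev sepIntegers (K : LocalField) : Subalgebra 𝒪[K] K.Sep := integralClosure 𝒪[K] K.Sep

/-- The inertia subgroup `I_K` of `G_K`: the automorphisms which act trivially on the ring of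
integers of `K^sep` modulo its maximal ideal. (The ring of integers of `K^sep` is a local ring, so
its maximal ideal is its Jacobson radical.) -/
def inertia (K : LocalField) : Subgroup K.absGal :=
  (Ideal.jacobson (⊥ : Ideal K.sepIntegers)).inertia K.absGal

/-- The set `S_{K,Γ}` of continuous homomorphisms `G_K → Γ`. -/
abbrev Rep (K : LocalField) (Γ : Type*) [Group Γ] [TopologicalSpace Γ] : Type _ :=
  K.absGal →ₜ* Γ

end LocalField

/-- A counting function for `Γ`: a function `c : ⋃_K S_{K,Γ} → ℤ_{≥0}`, where the union is over
isomorphism classes of local fields, with `c(ρ) = c(γ ρ γ⁻¹)` for all `γ ∈ Γ`. -/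
structure CountingFunction (Γ : Type v) [Group Γ] [TopologicalSpace Γ] where
  toFun : ∀ K : LocalField.{u}, K.Rep Γ → ℕ
  conj_inv : ∀ (K : LocalField.{u}) (ρ ρ' : K.Rep Γ) (γ : Γ),
    (∀ σ, ρ' σ = γ * ρ σ * γ⁻¹) → toFun K ρ' = toFun K ρ
  /-- The value depends only on the isomorphism class of the local field: it is invariant under
  the transport `ρ ↦ ρ'`, `ρ'(τ σ τ⁻¹) = ρ(σ)`, along an isomorphism `e : K ≅ K'` of local fields
  and an extension `τ : K^sep ≅ K'^sep` of `e`. -/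
  iso_inv : ∀ (K K' : LocalField.{u}) (e : K ≃+* K') (τ : K.Sep ≃+* K'.Sep),
    Continuous e → Continuous e.symm →
    (∀ x : K, τ (algebraMap K K.Sep x) = algebraMap K' K'.Sep (e x)) →
    ∀ (ρ : K.Rep Γ) (ρ' : K'.Rep Γ),
      (∀ (σ : K.absGal) (σ' : K'.absGal), (∀ x, σ' (τ x) = τ (σ x)) → ρ' σ' = ρ σ) →
      toFun K' ρ' = toFun K ρ

namespace CountingFunction

variable {Γ : Type v} [Group Γ] [TopologicalSpace Γ]

instance : CoeFun (CountingFunction.{u, v} Γ) (fun _ => ∀ K : LocalField.{u}, K.Rep Γ → ℕ) := ⟨toFun⟩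

/-- `c` is proper: for local fields with residue cardinality prime to `|Γ|`, the value `c(ρ)`
depends only on the image `ρ(I_K)` of the inertia subgroup. -/
def IsProper (c : CountingFunction.{u, v} Γ) : Prop :=
  ∀ (K K' : LocalField.{u}) (ρ : K.Rep Γ) (ρ' : K'.Rep Γ),
    K.q.Coprime (Nat.card Γ) → K'.q.Coprime (Nat.card Γ) →
    K.inertia.map ρ.toMonoidHom = K'.inertia.map ρ'.toMonoidHom →
    c K ρ = c K' ρ'

/-- The total mass `M(K,Γ,c) = ∑_{ρ ∈ S_{K,Γ}} q_K^{-c(ρ)}`, which is `∞` if the sum diverges. -/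
def totalMass (c : CountingFunction.{u, v} Γ) (K : LocalField.{u}) : ℝ≥0∞ :=
  ∑' ρ : K.Rep Γ, ((K.q : ℝ≥0∞) ^ c K ρ)⁻¹

/-- `(Γ,c)` has a mass formula for the class `S` of local fields: there is `f ∈ ℤ[x]` such that
`M(K,Γ,c)` is finite and equal to `f(1/q_K)` for all `K ∈ S`. -/
def HasMassFormula (c : CountingFunction.{u, v} Γ) (S : Set LocalField.{u}) : Prop :=
  ∃ f : ℤ[X], ∀ K ∈ S,
    c.totalMass K ≠ ∞ ∧ (c.totalMass K).toReal = f.aeval (1 / (K.q : ℝ))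

end CountingFunction

end

/-! Put n = |Γ| and let q = q_K be prime to n. A continuous homomorphism ρ from G_K to Γ kills wild
inertia, so it is determined by the images s of a Frobenius element F and t of a generator τ of tame
inertia. The only relation is s t s⁻¹ = t ^ q, and ρ(I_K) is generated by t (`exists_rep_equiv`).
Since t ^ n = 1, this relation depends only on q modulo n. Hence all K in the class share one finite
set of pairs, properness makes c the same function on it, and M(K,Γ,c) is the value at 1/q of a
fixed sum of monomials.

The tame structure is derived from the axioms `IsTameValuation`, without ramification groups. At
finite level g is recorded by two exponents, g ϖ = ζ ^ a * ϖ and g ω = ω ^ q ^ d, where ϖ is an n-th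
root of a uniformizer, ζ is a primitive n-th root of unity and ω is one of order q ^ M - 1. Three
facts carry the proof: inertia moves ϖ to ζ ϖ (`exists_mem_inertia_apply_eq`); ρ kills inertia
fixing ϖ (`map_eq_one_of_mem_inertia`), hence everything fixing ϖ and ω for suitable M
(`map_eq_one`); and g ↦ t ^ a * s ^ d is a homomorphism (`exists_hom`). A recurring device is that
integers prime to q have absolute value 1, so averaging over that many terms loses nothing.

`isTameValuation` checks the axioms for the spectral norm. -/

noncomputable section

/-- An absolute value on a Galois extension `Ω` of `K` that behaves like the extension of the
absolute value of a local field with residue field of cardinality `q`. -/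
structure IsTameValuation (K : Type*) {Ω : Type*} [Field K] [Field Ω] [Algebra K Ω]
    (v : AbsoluteValue Ω ℝ) (q : ℕ) : Prop where
  nonarch : IsNonarchimedean v
  invariant : ∀ (g : Ω ≃ₐ[K] Ω) (x : Ω), v (g x) = v x
  discrete : ∃ π : K, 0 < v (algebraMap K Ω π) ∧ v (algebraMap K Ω π) < 1 ∧
    ∀ x : K, x ≠ 0 → ∃ m : ℤ, v (algebraMap K Ω x) = v (algebraMap K Ω π) ^ m
  one_lt : 1 < q
  natCast : ∀ n : ℕ, n.Coprime q → v (n : Ω) = 1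
  frobenius : ∃ F : Ω ≃ₐ[K] Ω, ∀ x : Ω, v x ≤ 1 → v (F x - x ^ q) < 1
  eq_frobenius : ∀ (g : Ω ≃ₐ[K] Ω) (x : Ω), v x ≤ 1 → ∃ k : ℕ, v (g x - x ^ q ^ k) < 1
  torsion : ∀ x : Ω, v x = 1 → ∃ N : ℕ, N.Coprime q ∧ v (x ^ N - 1) < 1

/-! ### Roots of unity of order prime to q, and inertia -/

namespace IsTameValuation

section

variable {K Ω : Type*} [Field K] [Field Ω] [Algebra K Ω] {v : AbsoluteValue Ω ℝ} {q : ℕ}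

lemma sub_le (h : IsTameValuation K v q) (x y : Ω) : v (x - y) ≤ max (v x) (v y) := by
  have := h.nonarch x (-y)
  rwa [← sub_eq_add_neg, AbsoluteValue.map_neg] at this

lemma sum_lt (h : IsTameValuation K v q) {ι : Type*} (s : Finset ι) (f : ι → Ω) {r : ℝ}
    (hr : 0 < r) (hf : ∀ i ∈ s, v (f i) < r) : v (∑ i ∈ s, f i) < r := by
  classical
  induction s using Finset.induction_on with
  | empty => simpa
  | insert i s hi ih =>
    rw [Finset.sum_insert hi]
    exact (h.nonarch _ _).trans_lt (max_lt (hf _ (by simp))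
      (ih fun j hj => hf j (by simp [hj])))

lemma sum_le (h : IsTameValuation K v q) {ι : Type*} (s : Finset ι) (f : ι → Ω) {r : ℝ}
    (hr : 0 ≤ r) (hf : ∀ i ∈ s, v (f i) ≤ r) : v (∑ i ∈ s, f i) ≤ r := by
  classical
  induction s using Finset.induction_on with
  | empty => simpa
  | insert i s hi ih =>
    rw [Finset.sum_insert hi]
    exact (h.nonarch _ _).trans (max_le (hf _ (by simp))
      (ih fun j hj => hf j (by simp [hj])))

lemma ne_zero_of_coprime (h : IsTameValuation K v q) {N : ℕ} (hN : N.Coprime q) : N ≠ 0 := by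
  rintro rfl
  have := h.one_lt
  simp at hN
  omega

lemma coprime_pow_sub_one (h : IsTameValuation K v q) {M : ℕ} (hM : M ≠ 0) :
    (q ^ M - 1).Coprime q := by
  have h1 : 1 ≤ q ^ M := Nat.one_le_pow _ _ (by have := h.one_lt; omega)
  have : (q ^ M - 1).Coprime (q ^ M) := by
    have := (Nat.coprime_self_sub_left h1 (n := q ^ M)).2 (by simp)
    exact this
  exact Nat.Coprime.coprime_dvd_right (dvd_pow_self q hM) this

lemma dvd_pow_sub_one {N M : ℕ} (hN : N.Coprime q) (hM : N.totient ∣ M) : N ∣ q ^ M - 1 := by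
  obtain ⟨k, rfl⟩ := hM
  have := (Nat.ModEq.pow_totient hN.symm).pow k
  rw [one_pow, ← pow_mul] at this
  rcases Nat.eq_zero_or_pos q with rfl | hq
  · have : N = 1 := by simpa using hN
    simp [this]
  exact (Nat.modEq_iff_dvd' (Nat.one_le_pow _ _ hq)).1 this.symm

lemma map_of_pow_eq_one {N : ℕ} (hN : N ≠ 0) {u : Ω} (hu : u ^ N = 1) : v u = 1 := by
  have : v u ^ N = 1 := by rw [← map_pow, hu, map_one]
  exact (pow_eq_one_iff_of_nonneg (v.nonneg _) hN).1 this

lemma map_pow_sub_one_lt (h : IsTameValuation K v q) {u : Ω} (hu : v (u - 1) < 1) (i : ℕ) :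
    v (u ^ i - 1) < 1 := by
  have hu1 : v u ≤ 1 := by
    have := h.nonarch (u - 1) 1
    simp only [sub_add_cancel, map_one] at this
    exact this.trans (max_le hu.le le_rfl)
  rw [← geom_sum_mul u i, map_mul]
  refine mul_lt_one_of_nonneg_of_lt_one_right ?_ (v.nonneg _) hu
  exact h.sum_le _ _ zero_le_one fun j _ => by
    rw [map_pow]; exact pow_le_one₀ (v.nonneg _) hu1

/-- If u ≠ 1, its first N powers sum to 0, so the N small terms u ^ i - 1 sum to -N, which has
absolute value 1. Thus roots of unity of order prime to q are separated by reduction. -/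
lemma eq_one_of_pow_eq_one (h : IsTameValuation K v q) {N : ℕ} (hN : N.Coprime q) {u : Ω}
    (hu : u ^ N = 1) (hu1 : v (u - 1) < 1) : u = 1 := by
  by_contra hne
  have h0 : ∑ i ∈ Finset.range N, u ^ i = 0 := by
    have := geom_sum_mul u N
    rw [hu, sub_self] at this
    exact (mul_eq_zero.1 this).resolve_right (sub_ne_zero.2 hne)
  have h1 : ∑ i ∈ Finset.range N, (u ^ i - 1) = -(N : Ω) := by simp [h0]
  have h2 := h.sum_lt (Finset.range N) (fun i => u ^ i - 1) zero_lt_one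
    fun i _ => h.map_pow_sub_one_lt hu1 i
  rw [h1, AbsoluteValue.map_neg, h.natCast N hN] at h2
  exact lt_irrefl _ h2

lemma eq_of_pow_eq_one (h : IsTameValuation K v q) {N : ℕ} (hN : N.Coprime q) {x y : Ω}
    (hx : x ^ N = 1) (hy : y ^ N = 1) (hxy : v (x - y) < 1) : x = y := by
  have hy1 := map_of_pow_eq_one (v := v) (h.ne_zero_of_coprime hN) hy
  have hy0 : y ≠ 0 := by rintro rfl; simp at hy1
  have : x / y = 1 := h.eq_one_of_pow_eq_one hN (by rw [div_pow, hx, hy, div_one]) (by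
    rw [div_sub_one hy0, map_div₀, hy1, div_one]; exact hxy)
  rwa [div_eq_one_iff_eq hy0] at this

/-- The inertia subgroup of an absolute value. -/
def inertia (h : IsTameValuation K v q) : Subgroup (Ω ≃ₐ[K] Ω) where
  carrier := {g | ∀ x, v x ≤ 1 → v (g x - x) < 1}
  one_mem' := fun _ _ => by simp
  mul_mem' := fun {a b} ha hb x hx => by
    have : (a * b) x - x = a (b x - x) + (a x - x) := by simp
    rw [this]
    exact (h.nonarch _ _).trans_lt (max_lt (by rw [h.invariant]; exact hb x hx) (ha x hx))
  inv_mem' := fun {a} ha x hx => by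
    have : a⁻¹ x - x = -(a (a⁻¹ x) - a⁻¹ x) := by
      rw [← AlgEquiv.mul_apply, mul_inv_cancel]; simp
    rw [this, AbsoluteValue.map_neg]
    exact ha _ (by rw [h.invariant]; exact hx)

lemma mem_inertia (h : IsTameValuation K v q) {g : Ω ≃ₐ[K] Ω} :
    g ∈ h.inertia ↔ ∀ x, v x ≤ 1 → v (g x - x) < 1 := Iff.rfl

lemma primitiveRoot_exists [IsSepClosed Ω] (h : IsTameValuation K v q) {N : ℕ}
    (hN : N.Coprime q) : ∃ ξ : Ω, IsPrimitiveRoot ξ N := by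
  have : NeZero (N : Ω) := ⟨fun h0 => by simpa [h0] using h.natCast N hN⟩
  exact HasEnoughRootsOfUnity.prim

/-- Since x ^ N - 1 is the product of the x - ξ over N-th roots of unity ξ, its being small forces a
small factor: every unit has a Teichmüller-like approximation. -/
lemma exists_root_of_unity [IsSepClosed Ω] (h : IsTameValuation K v q) {x : Ω} (hx : v x = 1) :
    ∃ N : ℕ, N.Coprime q ∧ ∃ ξ : Ω, ξ ^ N = 1 ∧ v (x - ξ) < 1 := by
  obtain ⟨N, hN, hxN⟩ := h.torsion x hx
  obtain ⟨ω, hω⟩ := h.primitiveRoot_exists hN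
  have hN0 := h.ne_zero_of_coprime hN
  have := Polynomial.X_pow_sub_one_eq_prod (Nat.pos_of_ne_zero hN0) hω
  have := congrArg (Polynomial.eval x) this
  simp only [Polynomial.eval_sub, Polynomial.eval_pow, Polynomial.eval_X, Polynomial.eval_one,
    Polynomial.eval_prod, Polynomial.eval_C] at this
  rw [this, map_prod] at hxN
  by_contra! hcon
  refine absurd hxN (not_lt.2 ?_)
  refine Finset.prod_induction _ (fun r : ℝ => 1 ≤ r) (fun _ _ => one_le_mul_of_one_le_of_one_le)
    le_rfl fun ξ hξ => hcon N hN ξ ?_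
  exact (Polynomial.mem_nthRootsFinset (Nat.pos_of_ne_zero hN0) _).1 hξ

/-- Units are approximated by roots of unity of order prime to q, and these inject into the residue
field, so they detect the residual action. -/
lemma mem_inertia_iff [IsSepClosed Ω] (h : IsTameValuation K v q) {g : Ω ≃ₐ[K] Ω} :
    g ∈ h.inertia ↔ ∀ N : ℕ, N.Coprime q → ∀ ξ : Ω, ξ ^ N = 1 → g ξ = ξ := by
  constructor
  · intro hg N hN ξ hξ
    have h1 := map_of_pow_eq_one (v := v) (h.ne_zero_of_coprime hN) hξ
    exact h.eq_of_pow_eq_one hN (by rw [← map_pow, hξ, map_one]) hξ (hg ξ h1.le)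
  · intro hg x hx
    rcases hx.lt_or_eq with hx | hx
    · exact (h.sub_le _ _).trans_lt (max_lt (by rwa [h.invariant]) hx)
    obtain ⟨N, hN, ξ, hξ, hxξ⟩ := h.exists_root_of_unity hx
    have : g x - x = g (x - ξ) - (x - ξ) := by rw [map_sub, hg N hN ξ hξ]; ring
    rw [this]
    exact (h.sub_le _ _).trans_lt (max_lt (by rwa [h.invariant]) hxξ)

lemma exists_apply_eq_pow (h : IsTameValuation K v q) (g : Ω ≃ₐ[K] Ω) {N : ℕ}
    (hN : N.Coprime q) {ξ : Ω} (hξ : ξ ^ N = 1) : ∃ k : ℕ, g ξ = ξ ^ q ^ k := by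
  have h1 := map_of_pow_eq_one (v := v) (h.ne_zero_of_coprime hN) hξ
  obtain ⟨k, hk⟩ := h.eq_frobenius g ξ h1.le
  exact ⟨k, h.eq_of_pow_eq_one hN (by rw [← map_pow, hξ, map_one])
    (by rw [pow_right_comm, hξ, one_pow]) hk⟩

lemma frobenius_apply (h : IsTameValuation K v q) {F : Ω ≃ₐ[K] Ω}
    (hF : ∀ x : Ω, v x ≤ 1 → v (F x - x ^ q) < 1) {N : ℕ}
    (hN : N.Coprime q) {ξ : Ω} (hξ : ξ ^ N = 1) : F ξ = ξ ^ q := by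
  have h1 := map_of_pow_eq_one (v := v) (h.ne_zero_of_coprime hN) hξ
  exact h.eq_of_pow_eq_one hN (by rw [← map_pow, hξ, map_one])
    (by rw [pow_right_comm, hξ, one_pow]) (hF ξ h1.le)

lemma iterate_frobenius_apply {F : Ω ≃ₐ[K] Ω} {ξ : Ω} (hF : F ξ = ξ ^ q) (k : ℕ) :
    (F ^ k) ξ = ξ ^ q ^ k := by
  induction k with
  | zero => simp
  | succ k ih => rw [pow_succ, AlgEquiv.mul_apply, hF, map_pow, ih, ← pow_mul, ← pow_succ]

end

end IsTameValuation

/-! ### Unramified extensions, and tame inertia acting on roots of a uniformizer -/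

namespace IsTameValuation

section

variable {K Ω : Type*} [Field K] [Field Ω] [Algebra K Ω] {v : AbsoluteValue Ω ℝ} {q : ℕ}

lemma isOpen_stabilizer [Algebra.IsIntegral K Ω] (x : Ω) :
    IsOpen ((MulAction.stabilizer (Ω ≃ₐ[K] Ω) x : Subgroup (Ω ≃ₐ[K] Ω)) : Set (Ω ≃ₐ[K] Ω)) :=
  stabilizer_isOpen_of_isIntegral x

/-- An automorphism fixing sufficiently many roots of unity of order prime to `q` differs from
an element of inertia by an element of a given open subgroup. -/
lemma exists_mem_inertia_of_fixing [IsGalois K Ω] [IsSepClosed Ω] (h : IsTameValuation K v q)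
    {U : Subgroup (Ω ≃ₐ[K] Ω)} (hU : IsOpen (U : Set (Ω ≃ₐ[K] Ω))) {m : ℕ} (hm : m ≠ 0) :
    ∃ M : ℕ, M ≠ 0 ∧ m ∣ M ∧ ∀ g : Ω ≃ₐ[K] Ω, (∀ ξ : Ω, ξ ^ (q ^ M - 1) = 1 → g ξ = ξ) →
      ∃ i ∈ h.inertia, i⁻¹ * g ∈ U := by
  -- Compactness: the closed sets `V M` decrease along divisibility and intersect in inertia, so
  -- some `V M` already lies in the open set of products of inertia with `U`.
  let V : {M : ℕ // M ≠ 0} → Set (Ω ≃ₐ[K] Ω) := fun M =>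
    {g | ∀ ξ : Ω, ξ ^ (q ^ M.1 - 1) = 1 → g ξ = ξ}
  have hmono : ∀ M M' : {M : ℕ // M ≠ 0}, M.1 ∣ M'.1 → V M' ⊆ V M := by
    intro M M' hd g hg ξ hξ
    refine hg ξ ?_
    obtain ⟨k, hk⟩ := Nat.pow_sub_one_dvd_pow_sub_one q hd
    rw [hk, pow_mul, hξ, one_pow]
  have hdir : Directed (· ⊇ ·) V := fun M M' =>
    ⟨⟨M.1 * M'.1, mul_ne_zero M.2 M'.2⟩, hmono _ _ (Dvd.intro _ rfl), hmono _ _ (Dvd.intro_left _ rfl)⟩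
  have hclosed : ∀ M, IsClosed (V M) := by
    intro M
    have : V M = ⋂ ξ : {ξ : Ω // ξ ^ (q ^ M.1 - 1) = 1},
        ((MulAction.stabilizer (Ω ≃ₐ[K] Ω) ξ.1 : Subgroup (Ω ≃ₐ[K] Ω)) : Set (Ω ≃ₐ[K] Ω)) := by
      ext g
      simp [V, MulAction.mem_stabilizer_iff]
    rw [this]
    exact isClosed_iInter fun ξ => Subgroup.isClosed_of_isOpen _ (isOpen_stabilizer _)
  have : Nonempty {M : ℕ // M ≠ 0} := ⟨⟨1, one_ne_zero⟩⟩
  obtain ⟨M, hM⟩ := exists_subset_nhds_of_isCompact' hdir (fun M => (hclosed M).isCompact) hclosed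
    (U := {g | ∃ i ∈ h.inertia, i⁻¹ * g ∈ U}) (by
      intro x hx
      have hxI : x ∈ h.inertia := by
        rw [h.mem_inertia_iff]
        intro N hN ξ hξ
        have hN0 := h.ne_zero_of_coprime hN
        refine Set.mem_iInter.1 hx ⟨N.totient, by simpa using hN0⟩ ξ ?_
        obtain ⟨k, hk⟩ := dvd_pow_sub_one hN dvd_rfl
        rw [hk, pow_mul, hξ, one_pow]
      have hx1 : {g : Ω ≃ₐ[K] Ω | x⁻¹ * g ∈ U} ∈ nhds x :=
        (hU.preimage (continuous_const_mul x⁻¹)).mem_nhds (by simp)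
      exact Filter.mem_of_superset hx1 fun g hg => ⟨x, hxI, hg⟩)
  refine ⟨M.1 * m, mul_ne_zero M.2 hm, Dvd.intro_left _ rfl, fun g hg => hM ?_⟩
  exact hmono M ⟨M.1 * m, mul_ne_zero M.2 hm⟩ (Dvd.intro _ rfl) hg

lemma sum_range_add_eq_of_periodic {A : Type*} [AddCommGroup A] {f : ℕ → A} {M : ℕ}
    (hf : ∀ i, f (i + M) = f i) (k : ℕ) :
    ∑ i ∈ Finset.range M, f (i + k) = ∑ i ∈ Finset.range M, f i := by
  induction k with
  | zero => rfl
  | succ k ih =>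
    rw [← ih]
    have h1 := Finset.sum_range_succ (fun i => f (i + k)) M
    have h2 := Finset.sum_range_succ' (fun i => f (i + k)) M
    have h3 : f (M + k) = f (0 + k) := by rw [add_comm M k, hf, zero_add]
    rw [h1, h3] at h2
    have h4 := add_right_cancel h2
    rw [h4]
    exact Finset.sum_congr rfl fun i _ => by congr 1; ring

/-- The field generated by a root of unity of order prime to `q` has the same value group
as `K`. -/
lemma exists_map_eq_of_fixed [IsGalois K Ω] (h : IsTameValuation K v q)
    {F : Ω ≃ₐ[K] Ω} (hF : ∀ x : Ω, v x ≤ 1 → v (F x - x ^ q) < 1) {M : ℕ} (hM : M ≠ 0)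
    {ω : Ω} (hω : IsPrimitiveRoot ω (q ^ M - 1)) {y : Ω} (hy0 : y ≠ 0)
    (hy : ∀ g : Ω ≃ₐ[K] Ω, g ω = ω → g y = y) :
    ∃ a : K, a ≠ 0 ∧ v (algebraMap K Ω a) = v y := by
  have hN := h.coprime_pow_sub_one hM
  have hq := h.one_lt
  have hN0 := h.ne_zero_of_coprime hN
  set N := q ^ M - 1 with hNdef
  have hv1 : v ω = 1 := map_of_pow_eq_one hN0 hω.pow_eq_one
  have hω0 : ω ≠ 0 := by rintro rfl; simp at hv1
  have hFω : ∀ k, (F ^ k) ω = ω ^ q ^ k :=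
    iterate_frobenius_apply (h.frobenius_apply hF hN hω.pow_eq_one)
  have key : ∀ (g : Ω ≃ₐ[K] Ω) (k : ℕ), g ω = ω ^ q ^ k → g y = (F ^ k) y := by
    intro g k hg
    have := hy ((F ^ k)⁻¹ * g) (by
      rw [AlgEquiv.mul_apply, hg, ← hFω, ← AlgEquiv.mul_apply, inv_mul_cancel]; rfl)
    calc g y = (F ^ k * ((F ^ k)⁻¹ * g)) y := by rw [mul_inv_cancel_left]
      _ = (F ^ k) y := by rw [AlgEquiv.mul_apply, this]
  have hqM : ω ^ q ^ M = ω := by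
    have : q ^ M = N + 1 := by have := Nat.one_le_pow M q (by omega); omega
    rw [this, pow_succ, hω.pow_eq_one, one_mul]
  have hFM : (F ^ M) y = y := hy _ (by rw [hFω, hqM])
  -- The terms `T j i`, for i < M, are the conjugates of ω ^ j * y over K; their sum is the trace
  -- from K(ω).
  let T : ℕ → ℕ → Ω := fun j i => (F ^ i) (ω ^ j * y)
  have hT : ∀ j i, T j i = (ω ^ q ^ i) ^ j * (F ^ i) y := fun j i => by
    simp only [T, map_mul, map_pow, hFω]
  have hTper : ∀ j i, T j (i + M) = T j i := fun j i => by
    rw [hT, hT, pow_add F, AlgEquiv.mul_apply, hFM, ← hFω, pow_add F, AlgEquiv.mul_apply, hFω M,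
      hqM, hFω]
  have hTr : ∀ j, ∃ a : K, algebraMap K Ω a = ∑ i ∈ Finset.range M, T j i := by
    intro j
    rw [← Set.mem_range, InfiniteGalois.mem_range_algebraMap_iff_fixed]
    intro g
    obtain ⟨k, hk⟩ := h.exists_apply_eq_pow g hN hω.pow_eq_one
    rw [map_sum, ← sum_range_add_eq_of_periodic (hTper j) k]
    refine Finset.sum_congr rfl fun i _ => ?_
    have h1 : (g * F ^ i) ω = ω ^ q ^ (i + k) := by
      rw [AlgEquiv.mul_apply, hFω, map_pow, hk, ← pow_mul, ← pow_add, add_comm]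
    rw [hT j (i + k), ← key (g * F ^ i) (i + k) h1, ← h1]
    simp only [T, map_mul, map_pow, AlgEquiv.mul_apply]
  -- Fourier inversion: for 0 < i < M the ratio ω⁻¹ * ω ^ q ^ i is a nontrivial N-th root of unity,
  -- so only i = 0 survives the sum over j.
  have hsum : ∑ j ∈ Finset.range N, (ω⁻¹) ^ j * ∑ i ∈ Finset.range M, T j i = (N : Ω) * y := by
    simp_rw [Finset.mul_sum]
    rw [Finset.sum_comm, Finset.sum_eq_single 0]
    · simp [hT, hω0]
    · intro i hi hi0
      have hiM := Finset.mem_range.1 hi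
      have hu : ω⁻¹ * ω ^ q ^ i ≠ 1 := by
        rw [Ne, inv_mul_eq_one₀ hω0]
        intro heq
        have h1 : 1 < q ^ i := Nat.one_lt_pow hi0 hq
        have h2 : q ^ i < q ^ M := Nat.pow_lt_pow_right hq hiM
        have h3 : ω ^ (q ^ i - 1) = 1 := by
          have : ω ^ (q ^ i - 1) * ω = 1 * ω := by
            rw [← pow_succ, Nat.sub_add_cancel h1.le, ← heq, one_mul]
          exact mul_right_cancel₀ hω0 this
        have := Nat.le_of_dvd (by omega) (hω.dvd_of_pow_eq_one _ h3)
        omega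
      have h0 : ∑ j ∈ Finset.range N, (ω⁻¹ * ω ^ q ^ i) ^ j = 0 := by
        have := geom_sum_mul (ω⁻¹ * ω ^ q ^ i) N
        rw [mul_pow, inv_pow, pow_right_comm, hω.pow_eq_one, one_pow, inv_one, one_mul,
          sub_self] at this
        exact (mul_eq_zero.1 this).resolve_right (sub_ne_zero.2 hu)
      have : ∀ j, (ω⁻¹) ^ j * T j i = (ω⁻¹ * ω ^ q ^ i) ^ j * (F ^ i) y := fun j => by
        rw [hT, mul_pow, mul_assoc]
      simp_rw [this]
      rw [← Finset.sum_mul, h0, zero_mul]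
    · intro hM'
      exact absurd (Finset.mem_range.2 (Nat.pos_of_ne_zero hM)) hM'
  -- If v y is not a value of K, every trace, lying in K, is strictly smaller than y; the inversion
  -- formula then makes N * y smaller than y, although v N = 1.
  by_contra! hcon
  have hlt : ∀ j, v (∑ i ∈ Finset.range M, T j i) < v y := by
    intro j
    have hle : v (∑ i ∈ Finset.range M, T j i) ≤ v y := h.sum_le _ _ (v.nonneg _) fun i _ => by
      simp only [T, h.invariant, map_mul, map_pow, hv1, one_pow, one_mul, le_refl]
    obtain ⟨a, ha⟩ := hTr j
    rw [← ha] at hle ⊢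
    rcases eq_or_ne a 0 with rfl | ha0
    · simpa using v.pos hy0
    · exact lt_of_le_of_ne hle (hcon a ha0)
  have := h.sum_lt (Finset.range N) (fun j => (ω⁻¹) ^ j * ∑ i ∈ Finset.range M, T j i)
    (v.pos hy0) fun j _ => by
      rw [map_mul, map_pow, map_inv₀, hv1, inv_one, one_pow, one_mul]; exact hlt j
  rw [hsum, map_mul, h.natCast N hN, one_mul] at this
  exact lt_irrefl _ this

/-- `ϖ` is an `n`-th root of a uniformizer of `K`. -/
structure IsUniformizerRoot (v : AbsoluteValue Ω ℝ) (K : Type*) [Field K] [Algebra K Ω]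
    (n : ℕ) (ϖ : Ω) : Prop where
  pos : 0 < v ϖ
  lt_one : v ϖ < 1
  pow_mem : ∃ π : K, algebraMap K Ω π = ϖ ^ n
  value : ∀ x : K, x ≠ 0 → ∃ m : ℤ, v (algebraMap K Ω x) = v ϖ ^ (n * m)

lemma IsUniformizerRoot.ne_zero {n : ℕ} {ϖ : Ω} (hϖ : IsUniformizerRoot v K n ϖ) : ϖ ≠ 0 := by
  rintro rfl
  simpa using hϖ.pos

lemma exists_isUniformizerRoot [IsSepClosed Ω] (h : IsTameValuation K v q) {n : ℕ}
    (hn : n.Coprime q) : ∃ ϖ : Ω, IsUniformizerRoot v K n ϖ := by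
  obtain ⟨π, h0, h1, hπ⟩ := h.discrete
  have hn0 := h.ne_zero_of_coprime hn
  have : NeZero (n : Ω) := ⟨fun h0 => by simpa [h0] using h.natCast n hn⟩
  obtain ⟨ϖ, hϖ⟩ := IsSepClosed.exists_pow_nat_eq (algebraMap K Ω π) n
  have hv : v ϖ ^ n = v (algebraMap K Ω π) := by rw [← map_pow, hϖ]
  refine ⟨ϖ, (v.nonneg _).lt_of_ne ?_, ?_, ⟨π, hϖ.symm⟩, fun x hx => ?_⟩
  · intro h2
    rw [← h2, zero_pow hn0] at hv
    exact h0.ne hv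
  · by_contra! h2
    exact absurd (hv ▸ h1) (not_lt.2 (one_le_pow₀ h2))
  · obtain ⟨m, hm⟩ := hπ x hx
    exact ⟨m, by rw [hm, ← hv, zpow_mul, zpow_natCast]⟩

lemma IsUniformizerRoot.exists_apply_eq {n : ℕ} {ϖ : Ω} (hϖ : IsUniformizerRoot v K n ϖ)
    (hn : n ≠ 0) {ζ : Ω} (hζ : IsPrimitiveRoot ζ n) (g : Ω ≃ₐ[K] Ω) :
    ∃ a : ℕ, g ϖ = ζ ^ a * ϖ := by
  obtain ⟨π, hπ⟩ := hϖ.pow_mem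
  have : NeZero n := ⟨hn⟩
  obtain ⟨a, -, ha⟩ := hζ.eq_pow_of_pow_eq_one (ξ := g ϖ / ϖ) (by
    rw [div_pow, ← map_pow, ← hπ, AlgEquiv.commutes, div_self]
    rw [hπ]
    exact pow_ne_zero _ hϖ.ne_zero)
  exact ⟨a, by rw [ha, div_mul_cancel₀ _ hϖ.ne_zero]⟩

/-- Tame inertia acts transitively on the `n`-th roots of a uniformizer. -/
lemma exists_mem_inertia_apply_eq [IsGalois K Ω] [IsSepClosed Ω] (h : IsTameValuation K v q)
    {n : ℕ} (hn : n.Coprime q) {ϖ ζ : Ω} (hϖ : IsUniformizerRoot v K n ϖ)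
    (hζ : IsPrimitiveRoot ζ n) : ∃ τ ∈ h.inertia, τ ϖ = ζ * ϖ := by
  have hn0 := h.ne_zero_of_coprime hn
  have hζ0 : ζ ≠ 0 := hζ.ne_zero hn0
  have hIζ : ∀ i ∈ h.inertia, i ζ = ζ := fun i hi =>
    h.mem_inertia_iff.1 hi n hn ζ hζ.pow_eq_one
  -- `S` consists of the exponents a for which ϖ ↦ ζ ^ a * ϖ is realised by inertia. With d a
  -- generator and n = d * e, the element ϖ ^ e is fixed by inertia, so its absolute value is one
  -- from K. This gives e = n * m, whence d * m = 1.
  let S : AddSubgroup ℤ :=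
    { carrier := {a | ∃ i ∈ h.inertia, i ϖ = ζ ^ a * ϖ}
      zero_mem' := ⟨1, one_mem _, by simp⟩
      add_mem' := by
        rintro a b ⟨i, hi, ha⟩ ⟨j, hj, hb⟩
        refine ⟨i * j, mul_mem hi hj, ?_⟩
        rw [AlgEquiv.mul_apply, hb, map_mul, map_zpow₀, hIζ i hi, ha, zpow_add₀ hζ0]
        ring
      neg_mem' := by
        rintro a ⟨i, hi, ha⟩
        refine ⟨i⁻¹, inv_mem hi, ?_⟩
        apply i.injective
        rw [← AlgEquiv.mul_apply, mul_inv_cancel, map_mul, map_zpow₀, hIζ i hi, ha, ← mul_assoc,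
          ← zpow_add₀ hζ0]
        simp }
  suffices hS : (1 : ℤ) ∈ S by
    obtain ⟨i, hi, hi1⟩ := hS
    exact ⟨i, hi, by simpa using hi1⟩
  obtain ⟨d, hd⟩ := Int.subgroup_cyclic S
  have hmem : ∀ a, a ∈ S ↔ d ∣ a := fun a => by
    rw [hd, AddSubgroup.mem_closure_singleton]
    constructor
    · rintro ⟨k, rfl⟩; exact ⟨k, by simp [mul_comm]⟩
    · rintro ⟨k, rfl⟩; exact ⟨k, by simp [mul_comm]⟩
  have hnS : (n : ℤ) ∈ S := ⟨1, one_mem _, by simp [hζ.pow_eq_one]⟩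
  obtain ⟨e, he⟩ := (hmem _).1 hnS
  have he0 : e ≠ 0 := by rintro rfl; simp at he; exact hn0 he
  have hfix : ∀ i ∈ h.inertia, i (ϖ ^ e) = ϖ ^ e := by
    intro i hi
    obtain ⟨a, ha⟩ := hϖ.exists_apply_eq hn0 hζ i
    have haS : (a : ℤ) ∈ S := ⟨i, hi, by simpa using ha⟩
    obtain ⟨k, hk⟩ := (hmem _).1 haS
    have h1 : (ζ ^ a) ^ e = 1 := by
      rw [← zpow_natCast, ← zpow_mul, hk, mul_right_comm, ← he, zpow_mul, zpow_natCast,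
        hζ.pow_eq_one, one_zpow]
    rw [map_zpow₀, ha, mul_zpow, h1, one_mul]
  obtain ⟨F, hF⟩ := h.frobenius
  obtain ⟨M, hM, -, hU⟩ := h.exists_mem_inertia_of_fixing (isOpen_stabilizer (K := K) (ϖ ^ e))
    one_ne_zero
  obtain ⟨ω, hω⟩ := h.primitiveRoot_exists (h.coprime_pow_sub_one hM)
  have hN0 := h.ne_zero_of_coprime (h.coprime_pow_sub_one hM)
  obtain ⟨x, hx0, hx⟩ := h.exists_map_eq_of_fixed hF hM hω (zpow_ne_zero e hϖ.ne_zero) (by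
    intro g hg
    obtain ⟨i, hi, hig⟩ := hU g (fun ξ hξ => by
      have : NeZero (q ^ M - 1) := ⟨hN0⟩
      obtain ⟨k, -, rfl⟩ := hω.eq_pow_of_pow_eq_one hξ
      rw [map_pow, hg])
    rw [MulAction.mem_stabilizer_iff, AlgEquiv.smul_def, AlgEquiv.mul_apply] at hig
    have := congrArg i hig
    rw [← AlgEquiv.mul_apply, mul_inv_cancel, hfix i hi] at this
    exact this)
  obtain ⟨m, hm⟩ := hϖ.value x hx0
  rw [hx, map_zpow₀] at hm
  have := zpow_right_injective₀ hϖ.pos hϖ.lt_one.ne hm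
  rw [hmem]
  refine ⟨m, ?_⟩
  have h2 : e * 1 = e * (d * m) := by rw [mul_one]; nth_rewrite 1 [this]; rw [he]; ring
  exact mul_left_cancel₀ he0 h2

end

end IsTameValuation

/-! ### Homomorphisms to a finite group of order prime to q -/

namespace IsTameValuation

section

variable {K Ω : Type*} [Field K] [Field Ω] [Algebra K Ω] {v : AbsoluteValue Ω ℝ} {q : ℕ}
  {Γ : Type*} [Group Γ]

/-- The absolute value of an element fixed by the kernel of a homomorphism to a group of order
`n` is an integral power of that of an `n`-th root of a uniformizer. -/
lemma exists_map_eq_zpow_of_fixed_ker [IsGalois K Ω] (h : IsTameValuation K v q) [Finite Γ]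
    {ϖ : Ω} (hϖ : IsUniformizerRoot v K (Nat.card Γ) ϖ) (ρ : (Ω ≃ₐ[K] Ω) →* Γ) {y : Ω}
    (hy0 : y ≠ 0) (hy : ∀ g ∈ ρ.ker, g y = y) : ∃ m : ℤ, v y = v ϖ ^ m := by
  classical
  have : Fintype ρ.range := Fintype.ofFinite _
  let s : ρ.range → (Ω ≃ₐ[K] Ω) := fun γ => γ.2.choose
  have hs : ∀ γ, ρ (s γ) = γ := fun γ => γ.2.choose_spec
  have hact : ∀ g γ, ρ g = γ.1 → g y = s γ y := fun g γ hg => by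
    have := hy ((s γ)⁻¹ * g) (by rw [MonoidHom.mem_ker, map_mul, map_inv, hs, hg, inv_mul_cancel])
    calc g y = (s γ * ((s γ)⁻¹ * g)) y := by rw [mul_inv_cancel_left]
      _ = s γ y := by rw [AlgEquiv.mul_apply, this]
  -- This norm of y has as many factors of value v y as ρ has images, and that number divides n, so
  -- a root can be extracted in powers of v ϖ.
  obtain ⟨x, hx⟩ : ∃ x : K, algebraMap K Ω x = ∏ γ, s γ y := by
    rw [← Set.mem_range, InfiniteGalois.mem_range_algebraMap_iff_fixed]
    intro g
    rw [map_prod]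
    refine Fintype.prod_equiv (Equiv.mulLeft ⟨ρ g, g, rfl⟩) _ _ fun γ => ?_
    rw [← AlgEquiv.mul_apply]
    exact hact _ _ (by simp [hs])
  have hx0 : x ≠ 0 := by
    rintro rfl
    rw [map_zero] at hx
    obtain ⟨γ, -, hγ⟩ := Finset.prod_eq_zero_iff.1 hx.symm
    exact hy0 ((map_eq_zero_iff _ (s γ).injective).1 hγ)
  obtain ⟨m, hm⟩ := hϖ.value x hx0
  rw [hx, map_prod] at hm
  simp only [h.invariant, Finset.prod_const, Finset.card_univ] at hm
  obtain ⟨k, hk⟩ := Subgroup.card_subgroup_dvd_card ρ.range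
  rw [Nat.card_eq_fintype_card (α := ρ.range)] at hk
  refine ⟨k * m, ?_⟩
  have hc : Fintype.card ρ.range ≠ 0 := Fintype.card_ne_zero
  refine (pow_left_inj₀ (v.nonneg _) (zpow_nonneg hϖ.pos.le _) hc).1 ?_
  rw [hm, hk, ← zpow_natCast, ← zpow_mul]
  congr 1
  push_cast
  ring

/-- A homomorphism to a finite group of order prime to `q` kills the inertia elements which fix
a root of a uniformizer of degree the order of the group. -/
lemma map_eq_one_of_mem_inertia [IsGalois K Ω] (h : IsTameValuation K v q) [Finite Γ]
    (hn : (Nat.card Γ).Coprime q) {ϖ : Ω} (hϖ : IsUniformizerRoot v K (Nat.card Γ) ϖ)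
    (ρ : (Ω ≃ₐ[K] Ω) →* Γ) (hρ : IsOpen (ρ.ker : Set (Ω ≃ₐ[K] Ω))) {σ : Ω ≃ₐ[K] Ω}
    (hσ : σ ∈ h.inertia) (hσϖ : σ ϖ = ϖ) : ρ σ = 1 := by
  set n := Nat.card Γ with hndef
  have hn0 : n ≠ 0 := h.ne_zero_of_coprime hn
  have hnΩ : (n : Ω) ≠ 0 := fun h0 => by simpa [h0] using h.natCast n hn
  -- Write y = w * ϖ ^ m with w a unit: σ fixes ϖ and, being in inertia, moves w by less than 1.
  have hsmall : ∀ y : Ω, y ≠ 0 → (∀ g ∈ ρ.ker, g y = y) → ∀ j : ℕ, v ((σ ^ j) y - y) < v y := by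
    intro y hy0 hy j
    obtain ⟨m, hm⟩ := h.exists_map_eq_zpow_of_fixed_ker hϖ ρ hy0 hy
    have hp : ϖ ^ m ≠ 0 := zpow_ne_zero _ hϖ.ne_zero
    obtain ⟨w, rfl⟩ : ∃ w, y = w * ϖ ^ m := ⟨y / ϖ ^ m, (div_mul_cancel₀ _ hp).symm⟩
    have hw : v w = 1 := by
      rw [map_mul, map_zpow₀] at hm
      exact mul_right_cancel₀ (zpow_pos hϖ.pos m).ne' (hm.trans (one_mul _).symm)
    have hfix : (σ ^ j) ϖ = ϖ := by
      induction j with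
      | zero => rfl
      | succ j ih => rw [pow_succ, AlgEquiv.mul_apply, hσϖ, ih]
    rw [map_mul, map_zpow₀, hfix, ← sub_mul, map_mul, map_mul v, hw]
    exact mul_lt_mul_of_pos_right (pow_mem hσ j w hw.le) (v.pos hp)
  have hker : ∀ y : Ω, (∀ g ∈ ρ.ker, g y = y) → ∀ g : Ω ≃ₐ[K] Ω, ∀ k ∈ ρ.ker,
      k (g y) = g y := by
    intro y hy g k hk
    have := hy (g⁻¹ * k * g) (by
      have := ρ.normal_ker.conj_mem k hk g⁻¹
      rwa [inv_inv] at this)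
    calc k (g y) = (g * (g⁻¹ * k * g)) y := by
          rw [← AlgEquiv.mul_apply]; congr 1; group
      _ = g y := by rw [AlgEquiv.mul_apply, this]
  have hσn : σ ^ n ∈ ρ.ker := by
    rw [MonoidHom.mem_ker, map_pow, pow_card_eq_one']
  have hfixed : ∀ y : Ω, (∀ g ∈ ρ.ker, g y = y) → σ y = y := by
    intro y hy
    have hσy : σ (∑ j ∈ Finset.range n, (σ ^ j) y) = ∑ j ∈ Finset.range n, (σ ^ j) y := by
      rw [map_sum]
      have : ∀ j, σ ((σ ^ j) y) = (σ ^ (j + 1)) y := fun j => by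
        rw [pow_succ', AlgEquiv.mul_apply]
      simp_rw [this]
      exact sum_range_add_eq_of_periodic (f := fun j => (σ ^ j) y) (fun i => by
        rw [pow_add, AlgEquiv.mul_apply, hy _ hσn]) 1
    set S := ∑ j ∈ Finset.range n, (σ ^ j) y with hS
    have hSk : ∀ g ∈ ρ.ker, g S = S := by
      intro g hg
      rw [hS, map_sum]
      exact Finset.sum_congr rfl fun j _ => hker y hy _ g hg
    -- The first n conjugates σ ^ j z sum to 0, so the differences σ ^ j z - z sum to -n * z, of
    -- value v z. By `hsmall` this forces z = 0, and y = S / n is fixed by σ.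
    let z := (n : Ω) * y - S
    have hz : ∀ g ∈ ρ.ker, g z = z := fun g hg => by
      simp only [z, map_sub, map_mul, map_natCast, hy g hg, hSk g hg]
    have hSj : ∀ j : ℕ, (σ ^ j) S = S := fun j => by
      induction j with
      | zero => rfl
      | succ j ih => rw [pow_succ, AlgEquiv.mul_apply, hσy, ih]
    have hz0 : z = 0 := by
      by_contra hne
      have h1 : ∑ j ∈ Finset.range n, ((σ ^ j) z - z) = -((n : Ω) * z) := by
        have h2 : ∑ j ∈ Finset.range n, (σ ^ j) z = 0 := by
          simp only [z, map_sub, map_mul, map_natCast, hSj]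
          rw [Finset.sum_sub_distrib, ← Finset.mul_sum, ← hS]
          simp
        rw [Finset.sum_sub_distrib, h2]
        simp
      have h3 := h.sum_lt (Finset.range n) (fun j => (σ ^ j) z - z) (v.pos hne)
        fun j _ => hsmall z hne hz j
      rw [h1, AbsoluteValue.map_neg, map_mul, h.natCast n hn, one_mul] at h3
      exact lt_irrefl _ h3
    have h4 : (n : Ω) * y = S := sub_eq_zero.1 hz0
    have h5 : (n : Ω) * σ y = n * y := by
      rw [h4, ← hσy, ← h4, map_mul, map_natCast]
    exact mul_left_cancel₀ hnΩ h5
  -- Fixing the fixed field of the closed subgroup `ρ.ker` means lying in it, by the Galois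
  -- correspondence.
  let H : ClosedSubgroup (Ω ≃ₐ[K] Ω) := ⟨ρ.ker, Subgroup.isClosed_of_isOpen _ hρ⟩
  have hH := InfiniteGalois.fixingSubgroup_fixedField H
  rw [← MonoidHom.mem_ker]
  change σ ∈ H.toSubgroup
  rw [← hH, IntermediateField.mem_fixingSubgroup_iff]
  intro y hy
  exact hfixed y fun g hg => hy ⟨g, hg⟩

/-- A root of unity of order `q ^ M - 1` has `M` distinct conjugates. -/
lemma modEq_of_pow_pow_eq (h : IsTameValuation K v q) {M : ℕ} (hM : 1 < M) {ω : Ω}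
    (hω : IsPrimitiveRoot ω (q ^ M - 1)) {a b : ℕ} (hab : ω ^ q ^ a = ω ^ q ^ b) :
    a ≡ b [MOD M] := by
  have hq := h.one_lt
  have hM0 : M ≠ 0 := by omega
  have hN0 := h.ne_zero_of_coprime (h.coprime_pow_sub_one hM0)
  have hω0 := hω.ne_zero hN0
  have hqM : ω ^ q ^ M = ω := by
    have : q ^ M = (q ^ M - 1) + 1 := by have := Nat.one_le_pow M q (by omega); omega
    rw [this, pow_succ, hω.pow_eq_one, one_mul]
  have hqMk : ∀ k, ω ^ q ^ (M * k) = ω := fun k => by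
    induction k with
    | zero => simp
    | succ k ih => rw [mul_add, mul_one, pow_add, pow_mul, ih, hqM]
  have hred : ∀ a, ω ^ q ^ a = ω ^ q ^ (a % M) := fun a => by
    conv_lhs => rw [← Nat.div_add_mod a M, pow_add, pow_mul, hqMk]
  rw [hred a, hred b] at hab
  -- M > 1 is needed here: for q = 2 and M = 1 both sides equal 1.
  have hlt : ∀ a, q ^ (a % M) < q ^ M - 1 := fun a => by
    have h1 : q ^ (a % M) ≤ q ^ (M - 1) :=
      Nat.pow_le_pow_right (by omega) (by have := Nat.mod_lt a (Nat.pos_of_ne_zero hM0); omega)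
    have h2 : q ^ M = q ^ (M - 1) * q := by rw [← pow_succ]; congr 1; omega
    have h3 : 1 < q ^ (M - 1) := Nat.one_lt_pow (by omega) hq
    have h4 : q ^ (M - 1) * 2 ≤ q ^ (M - 1) * q := Nat.mul_le_mul_left _ hq
    omega
  have := hω.pow_inj (hlt a) (hlt b) hab
  exact Nat.pow_right_injective hq this

/-- Generators of the tame quotient of the Galois group: a Frobenius element and a generator of
tame inertia. -/
structure IsTamePair (h : IsTameValuation K v q) (n : ℕ) (ϖ ζ : Ω) (F τ : Ω ≃ₐ[K] Ω) : Prop where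
  root : IsUniformizerRoot v K n ϖ
  prim : IsPrimitiveRoot ζ n
  frobenius : ∀ x : Ω, v x ≤ 1 → v (F x - x ^ q) < 1
  frobenius_root : F ϖ = ϖ
  mem_inertia : τ ∈ h.inertia
  apply_root : τ ϖ = ζ * ϖ

lemma inertia_normal (h : IsTameValuation K v q) : h.inertia.Normal where
  conj_mem := fun i hi g x hx => by
    have : (g * i * g⁻¹) x - x = g (i (g⁻¹ x) - g⁻¹ x) := by
      rw [map_sub, AlgEquiv.mul_apply, AlgEquiv.mul_apply, ← AlgEquiv.mul_apply g g⁻¹,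
        mul_inv_cancel, AlgEquiv.one_apply]
    rw [this, h.invariant]
    exact hi _ (by rwa [h.invariant])

/-- Any Frobenius sends ϖ to some ζ ^ a * ϖ; composing with the inverse of τ ^ a makes it fix ϖ and
leaves its residual action unchanged. -/
lemma exists_isTamePair [IsGalois K Ω] [IsSepClosed Ω] (h : IsTameValuation K v q) {n : ℕ}
    (hn : n.Coprime q) : ∃ ϖ ζ F τ, h.IsTamePair n ϖ ζ F τ := by
  obtain ⟨ϖ, hϖ⟩ := h.exists_isUniformizerRoot (K := K) hn
  obtain ⟨ζ, hζ⟩ := h.primitiveRoot_exists hn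
  obtain ⟨τ, hτ, hτϖ⟩ := h.exists_mem_inertia_apply_eq hn hϖ hζ
  obtain ⟨F, hF⟩ := h.frobenius
  obtain ⟨a, ha⟩ := hϖ.exists_apply_eq (h.ne_zero_of_coprime hn) hζ F
  have hτζ : τ ζ = ζ := h.mem_inertia_iff.1 hτ n hn ζ hζ.pow_eq_one
  have hpow : ∀ j : ℕ, (τ ^ j) ϖ = ζ ^ j * ϖ := fun j => by
    induction j with
    | zero => simp
    | succ j ih =>
      rw [pow_succ', AlgEquiv.mul_apply, ih, map_mul, map_pow, hτζ, hτϖ, pow_succ, mul_assoc]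
  refine ⟨ϖ, ζ, (τ ^ a)⁻¹ * F, τ, hϖ, hζ, fun x hx => ?_, ?_, hτ, hτϖ⟩
  · have h1 : ((τ ^ a)⁻¹ * F) x - x ^ q = ((τ ^ a)⁻¹ (F x) - F x) + (F x - x ^ q) := by
      rw [AlgEquiv.mul_apply]; ring
    rw [h1]
    exact (h.nonarch _ _).trans_lt (max_lt (inv_mem (pow_mem hτ a) _ (by rwa [h.invariant]))
      (hF x hx))
  · apply (τ ^ a).injective
    rw [← AlgEquiv.mul_apply, mul_inv_cancel_left, ha, hpow]

namespace IsTamePair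

variable {h : IsTameValuation K v q} {n : ℕ} {ϖ ζ : Ω} {F τ : Ω ≃ₐ[K] Ω}

lemma pow_apply_root [IsSepClosed Ω] (hp : h.IsTamePair n ϖ ζ F τ) (hn : n.Coprime q) (j : ℕ) :
    (τ ^ j) ϖ = ζ ^ j * ϖ := by
  have hτζ : τ ζ = ζ := h.mem_inertia_iff.1 hp.mem_inertia n hn ζ hp.prim.pow_eq_one
  induction j with
  | zero => simp
  | succ j ih =>
    rw [pow_succ', AlgEquiv.mul_apply, ih, map_mul, map_pow, hτζ, hp.apply_root, pow_succ,
      mul_assoc]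

lemma frobenius_pow_root (hp : h.IsTamePair n ϖ ζ F τ) (j : ℕ) : (F ^ j) ϖ = ϖ := by
  induction j with
  | zero => rfl
  | succ j ih => rw [pow_succ, AlgEquiv.mul_apply, hp.frobenius_root, ih]

/-- The exponents describing the action of an element on the roots of a uniformizer and on the
roots of unity. -/
lemma exists_exponents (hp : h.IsTamePair n ϖ ζ F τ) (hn : n.Coprime q) {N : ℕ}
    (hN : N.Coprime q) {ω : Ω} (hω : ω ^ N = 1) (g : Ω ≃ₐ[K] Ω) :
    ∃ a d : ℕ, g ϖ = ζ ^ a * ϖ ∧ g ω = ω ^ q ^ d := by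
  obtain ⟨a, ha⟩ := hp.root.exists_apply_eq (h.ne_zero_of_coprime hn) hp.prim g
  obtain ⟨d, hd⟩ := h.exists_apply_eq_pow g hN hω
  exact ⟨a, d, ha, hd⟩

variable [IsGalois K Ω] [IsSepClosed Ω]

/-- Both F τ F⁻¹ and τ ^ q lie in inertia and send ϖ to ζ ^ q * ϖ, because F raises ζ to the q-th
power; ρ cannot distinguish them. -/
lemma map_conj [Finite Γ] (hp : h.IsTamePair (Nat.card Γ) ϖ ζ F τ) (hn : (Nat.card Γ).Coprime q)
    (ρ : (Ω ≃ₐ[K] Ω) →* Γ) (hρ : IsOpen (ρ.ker : Set (Ω ≃ₐ[K] Ω))) :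
    ρ F * ρ τ * (ρ F)⁻¹ = ρ τ ^ q := by
  have h1 : (τ ^ q)⁻¹ * (F * τ * F⁻¹) ∈ h.inertia :=
    mul_mem (inv_mem (pow_mem hp.mem_inertia q)) (h.inertia_normal.conj_mem _ hp.mem_inertia _)
  have hFinv : F⁻¹ ϖ = ϖ := by
    apply F.injective
    rw [← AlgEquiv.mul_apply, mul_inv_cancel, hp.frobenius_root, AlgEquiv.one_apply]
  have h2 := h.map_eq_one_of_mem_inertia hn hp.root ρ hρ h1 (by
    apply (τ ^ q).injective
    rw [← AlgEquiv.mul_apply, mul_inv_cancel_left, AlgEquiv.mul_apply, AlgEquiv.mul_apply, hFinv,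
      hp.apply_root, map_mul, h.frobenius_apply hp.frobenius hn hp.prim.pow_eq_one,
      hp.frobenius_root, hp.pow_apply_root hn])
  rw [map_mul, map_inv, inv_mul_eq_one, map_pow, map_mul, map_mul, map_inv] at h2
  exact h2.symm

lemma map_inertia [Finite Γ] (hp : h.IsTamePair (Nat.card Γ) ϖ ζ F τ) (hn : (Nat.card Γ).Coprime q)
    (ρ : (Ω ≃ₐ[K] Ω) →* Γ) (hρ : IsOpen (ρ.ker : Set (Ω ≃ₐ[K] Ω))) :
    h.inertia.map ρ = Subgroup.zpowers (ρ τ) := by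
  apply le_antisymm
  · rintro _ ⟨i, hi, rfl⟩
    obtain ⟨a, ha⟩ := hp.root.exists_apply_eq (h.ne_zero_of_coprime hn) hp.prim i
    have := h.map_eq_one_of_mem_inertia hn hp.root ρ hρ
      (mul_mem (inv_mem (pow_mem hp.mem_inertia a)) hi) (by
        apply (τ ^ a).injective
        rw [← AlgEquiv.mul_apply, mul_inv_cancel_left, ha, hp.pow_apply_root hn])
    rw [map_mul, map_inv, inv_mul_eq_one, map_pow] at this
    rw [← this]
    exact pow_mem (Subgroup.mem_zpowers _) a
  · rw [Subgroup.zpowers_le]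
    exact ⟨τ, hp.mem_inertia, rfl⟩

/-- A homomorphism kills the elements which fix an `n`-th root of a uniformizer and the roots
of unity of order dividing `q ^ M - 1`, if `n` divides `M`. -/
lemma map_eq_one [Finite Γ] (hp : h.IsTamePair (Nat.card Γ) ϖ ζ F τ) (hn : (Nat.card Γ).Coprime q)
    (ρ : (Ω ≃ₐ[K] Ω) →* Γ) (hρ : IsOpen (ρ.ker : Set (Ω ≃ₐ[K] Ω))) {M : ℕ} (hM : 1 < M)
    (hnM : Nat.card Γ ∣ M) {ω : Ω} (hω : IsPrimitiveRoot ω (q ^ M - 1)) {g : Ω ≃ₐ[K] Ω}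
    (hgϖ : g ϖ = ϖ) (hgω : g ω = ω) : ρ g = 1 := by
  -- Including the stabilizer of ϖ forces the inertia factor found below to fix ϖ, so that ρ kills
  -- it.
  have hU : IsOpen ((ρ.ker ⊓ MulAction.stabilizer (Ω ≃ₐ[K] Ω) ϖ : Subgroup (Ω ≃ₐ[K] Ω)) :
      Set (Ω ≃ₐ[K] Ω)) := hρ.inter (isOpen_stabilizer ϖ)
  obtain ⟨M', hM', hMM', hfix⟩ := h.exists_mem_inertia_of_fixing hU (m := M) (by omega)
  have hN' := h.coprime_pow_sub_one hM'
  have hN0 := h.ne_zero_of_coprime hN'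
  obtain ⟨ω', hω'⟩ := h.primitiveRoot_exists hN'
  obtain ⟨k, hk⟩ := h.exists_apply_eq_pow g hN' hω'.pow_eq_one
  have : NeZero (q ^ M' - 1) := ⟨hN0⟩
  have hgk : ∀ ξ : Ω, ξ ^ (q ^ M' - 1) = 1 → g ξ = (F ^ k) ξ := by
    intro ξ hξ
    obtain ⟨j, -, rfl⟩ := hω'.eq_pow_of_pow_eq_one hξ
    rw [map_pow, map_pow, hk,
      iterate_frobenius_apply (h.frobenius_apply hp.frobenius hN' hω'.pow_eq_one)]
  have hω1 : ω ^ (q ^ M' - 1) = 1 := by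
    obtain ⟨c, hc⟩ := Nat.pow_sub_one_dvd_pow_sub_one q hMM'
    rw [hc, pow_mul, hω.pow_eq_one, one_pow]
  have hMk : M ∣ k := by
    have h1 := hgk ω hω1
    rw [hgω, iterate_frobenius_apply (h.frobenius_apply hp.frobenius hN' hω1)] at h1
    have := h.modEq_of_pow_pow_eq hM hω (a := k) (b := 0) (by rw [← h1]; simp)
    exact (Nat.modEq_zero_iff_dvd).1 this
  -- On roots of unity of order dividing q ^ M' - 1, g acts as F ^ k. Removing F ^ k leaves inertia
  -- modulo the open subgroup, so ρ g = ρ F ^ k, which is trivial since n ∣ M ∣ k.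
  obtain ⟨i, hi, hU1, hU2⟩ := hfix ((F ^ k)⁻¹ * g) fun ξ hξ => by
    rw [AlgEquiv.mul_apply, hgk ξ hξ, ← AlgEquiv.mul_apply, inv_mul_cancel, AlgEquiv.one_apply]
  have hFk : (F ^ k)⁻¹ ϖ = ϖ := by
    apply (F ^ k).injective
    rw [← AlgEquiv.mul_apply, mul_inv_cancel, hp.frobenius_pow_root, AlgEquiv.one_apply]
  have hiϖ : i ϖ = ϖ := by
    have h2 : (i⁻¹ * ((F ^ k)⁻¹ * g)) ϖ = ϖ := hU2
    rw [AlgEquiv.mul_apply, AlgEquiv.mul_apply, hgϖ, hFk] at h2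
    have h3 := congrArg i h2
    rw [← AlgEquiv.mul_apply, mul_inv_cancel, AlgEquiv.one_apply] at h3
    exact h3.symm
  have hρi := h.map_eq_one_of_mem_inertia hn hp.root ρ hρ hi hiϖ
  have h4 : ρ (i⁻¹ * ((F ^ k)⁻¹ * g)) = 1 := hU1
  rw [map_mul, map_mul, map_inv, map_inv, hρi, inv_one, one_mul, inv_mul_eq_one, map_pow] at h4
  obtain ⟨c, hc⟩ := hnM.trans hMk
  rw [← h4, hc, pow_mul, pow_card_eq_one', one_pow]

/-- Each g agrees on ϖ and ω with some τ ^ a * F ^ d, and by `map_eq_one` homomorphisms see only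
this action. -/
lemma eq_of_map_eq [Finite Γ] (hp : h.IsTamePair (Nat.card Γ) ϖ ζ F τ) (hn : (Nat.card Γ).Coprime q)
    (ρ ρ' : (Ω ≃ₐ[K] Ω) →* Γ) (hρ : IsOpen (ρ.ker : Set (Ω ≃ₐ[K] Ω)))
    (hρ' : IsOpen (ρ'.ker : Set (Ω ≃ₐ[K] Ω))) (hF : ρ F = ρ' F) (hτ : ρ τ = ρ' τ) : ρ = ρ' := by
  have hn0 := h.ne_zero_of_coprime hn
  obtain ⟨M, hM, hnM⟩ : ∃ M, 1 < M ∧ Nat.card Γ ∣ M :=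
    ⟨Nat.card Γ * 2, by omega, Dvd.intro _ rfl⟩
  have hN := h.coprime_pow_sub_one (M := M) (by omega)
  obtain ⟨ω, hω⟩ := h.primitiveRoot_exists hN
  ext g
  obtain ⟨a, d, ha, hd⟩ := hp.exists_exponents hn hN hω.pow_eq_one g
  have h1 : ((τ ^ a * F ^ d)⁻¹ * g) ϖ = ϖ := by
    apply (τ ^ a * F ^ d).injective
    rw [← AlgEquiv.mul_apply, mul_inv_cancel_left, ha, AlgEquiv.mul_apply, hp.frobenius_pow_root,
      hp.pow_apply_root hn]
  have h2 : ((τ ^ a * F ^ d)⁻¹ * g) ω = ω := by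
    apply (τ ^ a * F ^ d).injective
    rw [← AlgEquiv.mul_apply, mul_inv_cancel_left, hd, AlgEquiv.mul_apply,
      iterate_frobenius_apply (h.frobenius_apply hp.frobenius hN hω.pow_eq_one), map_pow,
      h.mem_inertia_iff.1 (pow_mem hp.mem_inertia a) _ hN ω hω.pow_eq_one]
  have h3 := hp.map_eq_one hn ρ hρ hM hnM hω h1 h2
  have h4 := hp.map_eq_one hn ρ' hρ' hM hnM hω h1 h2
  rw [map_mul, map_inv, inv_mul_eq_one, map_mul, map_pow, map_pow] at h3 h4
  rw [← h3, ← h4, hF, hτ]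

lemma exists_hom (hp : h.IsTamePair (Nat.card Γ) ϖ ζ F τ) (hn : (Nat.card Γ).Coprime q)
    {s t : Γ} (hst : s * t * s⁻¹ = t ^ q) :
    ∃ ρ : (Ω ≃ₐ[K] Ω) →* Γ, IsOpen (ρ.ker : Set (Ω ≃ₐ[K] Ω)) ∧ ρ F = s ∧ ρ τ = t := by
  set n := Nat.card Γ with hndef
  have hn0 := h.ne_zero_of_coprime hn
  -- n ∣ M makes s ^ d depend only on d modulo M; n.totient ∣ M gives n ∣ q ^ M - 1, so that ζ is a
  -- power of ω and g acts on it through the same exponent d.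
  obtain ⟨M, hM, hnM, htM⟩ : ∃ M, 1 < M ∧ n ∣ M ∧ n.totient ∣ M := by
    refine ⟨n * 2 * n.totient, ?_, ⟨2 * n.totient, by ring⟩, Dvd.intro_left _ rfl⟩
    have := Nat.totient_pos.2 (Nat.pos_of_ne_zero hn0)
    nlinarith [Nat.pos_of_ne_zero hn0, Nat.mul_le_mul (Nat.pos_of_ne_zero hn0) this]
  have hN := h.coprime_pow_sub_one (M := M) (by omega)
  obtain ⟨ω, hω⟩ := h.primitiveRoot_exists hN
  have hex := fun g => hp.exists_exponents hn hN hω.pow_eq_one g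
  choose a d ha hd using hex
  have hval : ∀ (g : Ω ≃ₐ[K] Ω) (a' d' : ℕ), g ϖ = ζ ^ a' * ϖ → g ω = ω ^ q ^ d' →
      t ^ a g * s ^ d g = t ^ a' * s ^ d' := by
    intro g a' d' ha' hd'
    have h1 : a g ≡ a' [MOD n] := by
      rw [ha] at ha'
      rw [hp.prim.eq_orderOf]
      have hfin : IsOfFinOrder ζ := isOfFinOrder_iff_pow_eq_one.2
        ⟨n, Nat.pos_of_ne_zero hn0, hp.prim.pow_eq_one⟩
      exact hfin.pow_eq_pow_iff_modEq.1 (mul_right_cancel₀ hp.root.ne_zero ha')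
    have h2 : d g ≡ d' [MOD n] :=
      (h.modEq_of_pow_pow_eq hM hω ((hd g).symm.trans hd')).of_dvd hnM
    rw [pow_eq_pow_iff_modEq.2 (h1.of_dvd (orderOf_dvd_natCard t)),
      pow_eq_pow_iff_modEq.2 (h2.of_dvd (orderOf_dvd_natCard s))]
  have hcomm : ∀ d a : ℕ, s ^ d * t ^ a = t ^ (q ^ d * a) * s ^ d := by
    have h1 : ∀ a : ℕ, s * t ^ a = t ^ (q * a) * s := fun a => by
      rw [pow_mul, ← hst, conj_pow, inv_mul_cancel_right]
    intro d
    induction d with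
    | zero => simp
    | succ d ih =>
      intro a
      rw [pow_succ, mul_assoc, h1, ← mul_assoc, ih, mul_assoc, ← mul_assoc (q ^ d), ← pow_succ]
  let ρ : (Ω ≃ₐ[K] Ω) →* Γ :=
    { toFun := fun g => t ^ a g * s ^ d g
      map_one' := by
        rw [hval 1 0 0 (by simp) (by simp)]
        simp
      map_mul' := fun g g' => by
        rw [hval (g * g') (a g + q ^ d g * a g') (d g + d g') ?_ ?_]
        · rw [pow_add, pow_add, mul_assoc, ← mul_assoc _ (s ^ d g), ← hcomm]
          simp only [mul_assoc]
        · obtain ⟨k, hk⟩ : n ∣ q ^ M - 1 := dvd_pow_sub_one hn htM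
          have h1 : g ζ = ζ ^ q ^ d g := by
            have : NeZero (q ^ M - 1) := ⟨h.ne_zero_of_coprime hN⟩
            obtain ⟨j, -, hj⟩ := hω.eq_pow_of_pow_eq_one (ξ := ζ) (by
              rw [hk, pow_mul, hp.prim.pow_eq_one, one_pow])
            rw [← hj, map_pow, hd g, pow_right_comm]
          rw [AlgEquiv.mul_apply, ha g', map_mul, map_pow, h1, ha g, pow_add, pow_mul]
          ring
        · rw [AlgEquiv.mul_apply, hd g', map_pow, hd g, pow_add, pow_mul] }
  have hρ : ∀ g a' d', g ϖ = ζ ^ a' * ϖ → g ω = ω ^ q ^ d' → ρ g = t ^ a' * s ^ d' := hval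
  refine ⟨ρ, ?_, ?_, ?_⟩
  · refine Subgroup.isOpen_mono (H₁ := MulAction.stabilizer (Ω ≃ₐ[K] Ω) ϖ ⊓
      MulAction.stabilizer (Ω ≃ₐ[K] Ω) ω) ?_ ((isOpen_stabilizer ϖ).inter (isOpen_stabilizer ω))
    rintro g ⟨h1, h2⟩
    rw [MonoidHom.mem_ker, hρ g 0 0 (by simpa using h1) (by simpa using h2)]
    simp
  · rw [hρ F 0 1 (by simpa using hp.frobenius_root) (by
      simpa using h.frobenius_apply hp.frobenius hN hω.pow_eq_one)]
    simp
  · rw [hρ τ 1 0 (by simpa using hp.apply_root) (by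
      simpa using h.mem_inertia_iff.1 hp.mem_inertia _ hN ω hω.pow_eq_one)]
    simp

end IsTamePair

/-- Continuous homomorphisms from the Galois group to a finite group `Γ` of order prime to `q`
correspond to pairs `(s, t)` in `Γ` with `s t s⁻¹ = t ^ q`, and `t` generates the image of
inertia. -/
theorem exists_equiv_pairs [IsGalois K Ω] [IsSepClosed Ω] (h : IsTameValuation K v q) [Finite Γ]
    [TopologicalSpace Γ] [DiscreteTopology Γ] (hn : (Nat.card Γ).Coprime q) :
    ∃ e : ((Ω ≃ₐ[K] Ω) →ₜ* Γ) ≃ {p : Γ × Γ // p.1 * p.2 * p.1⁻¹ = p.2 ^ q},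
      ∀ ρ : (Ω ≃ₐ[K] Ω) →ₜ* Γ,
        h.inertia.map ρ.toMonoidHom = Subgroup.zpowers (e ρ).1.2 := by
  obtain ⟨ϖ, ζ, F, τ, hp⟩ := h.exists_isTamePair hn
  have hopen : ∀ ρ : (Ω ≃ₐ[K] Ω) →ₜ* Γ, IsOpen (ρ.toMonoidHom.ker : Set (Ω ≃ₐ[K] Ω)) :=
    fun ρ => (isOpen_discrete ({1} : Set Γ)).preimage ρ.continuous_toFun
  let f : ((Ω ≃ₐ[K] Ω) →ₜ* Γ) → {p : Γ × Γ // p.1 * p.2 * p.1⁻¹ = p.2 ^ q} :=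
    fun ρ => ⟨(ρ F, ρ τ), hp.map_conj hn ρ.toMonoidHom (hopen ρ)⟩
  have hf : Function.Bijective f := by
    constructor
    · intro ρ ρ' hρ
      have h1 := hp.eq_of_map_eq hn ρ.toMonoidHom ρ'.toMonoidHom (hopen ρ) (hopen ρ')
        (congrArg (fun p => p.1.1) hρ) (congrArg (fun p => p.1.2) hρ)
      ext g
      exact DFunLike.congr_fun h1 g
    · rintro ⟨⟨s, t⟩, hst⟩
      obtain ⟨ρ, hρ, rfl, rfl⟩ := hp.exists_hom hn hst
      have hcont : Continuous ρ := continuous_of_continuousAt_one ρ (by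
        rw [ContinuousAt, map_one, nhds_discrete Γ, Filter.tendsto_pure]
        exact hρ.mem_nhds (one_mem ρ.ker))
      exact ⟨⟨ρ, hcont⟩, rfl⟩
  exact ⟨Equiv.ofBijective f hf, fun ρ => hp.map_inertia hn ρ.toMonoidHom (hopen ρ)⟩

end

end IsTameValuation

/-! ### Integral closures and the spectral norm -/

namespace IsNonarchimedeanLocalField

section

variable {K Ω : Type*} [Field K] [ValuativeRel K] [Field Ω] [Algebra K Ω] {v : AbsoluteValue Ω ℝ}
  (hv : ∀ x : Ω, v x ≤ 1 ↔ IsIntegral 𝒪[K] x)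
include hv

lemma map_coe_le_one (x : integralClosure 𝒪[K] Ω) : v x ≤ 1 := (hv _).2 x.2

lemma isUnit_integralClosure_iff (x : integralClosure 𝒪[K] Ω) : IsUnit x ↔ v x = 1 := by
  constructor
  · rintro ⟨u, rfl⟩
    refine le_antisymm (map_coe_le_one hv _) ?_
    have h1 : v (u : integralClosure 𝒪[K] Ω) * v (u⁻¹ : (integralClosure 𝒪[K] Ω)ˣ) = 1 := by
      rw [← map_mul, ← MulMemClass.coe_mul, Units.mul_inv]; simp
    calc 1 = _ := h1.symm
      _ ≤ v (u : integralClosure 𝒪[K] Ω) * 1 :=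
        mul_le_mul_of_nonneg_left (map_coe_le_one hv _) (v.nonneg _)
      _ = _ := mul_one _
  · intro hx
    have hx0 : (x : Ω) ≠ 0 := by intro h0; rw [h0] at hx; simp at hx
    refine IsUnit.of_mul_eq_one ⟨(x : Ω)⁻¹, (hv _).1 (by rw [map_inv₀, hx, inv_one])⟩ ?_
    ext
    simp [hx0]

lemma map_algebraMap_le_one (x : 𝒪[K]) : v (algebraMap K Ω x) ≤ 1 :=
  (hv _).2 (isIntegral_algebraMap (R := 𝒪[K]) (A := Ω) (x := x))

lemma map_algebraMap_unit (u : 𝒪[K]ˣ) : v (algebraMap K Ω (u : 𝒪[K])) = 1 :=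
  (isUnit_integralClosure_iff hv _).1 (u.isUnit.map (algebraMap 𝒪[K] (integralClosure 𝒪[K] Ω)))

variable (hna : IsNonarchimedean v)
include hna

/-- Units are the elements of value 1, and x is in the radical when every x * y + 1 is a unit. This
translates `LocalField.inertia` into a condition on v. -/
lemma mem_jacobson_bot_iff (x : integralClosure 𝒪[K] Ω) :
    x ∈ Ideal.jacobson (⊥ : Ideal (integralClosure 𝒪[K] Ω)) ↔ v x < 1 := by
  rw [Ideal.mem_jacobson_bot]
  constructor
  · intro h
    refine lt_of_le_of_ne (map_coe_le_one hv x) fun h1 => ?_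
    obtain ⟨y, hy⟩ := ((isUnit_integralClosure_iff hv x).2 h1).exists_right_inv
    have h2 : x * -y + 1 = 0 := by linear_combination -hy
    have h3 := (isUnit_integralClosure_iff hv _).1 (h (-y))
    rw [h2] at h3
    simp at h3
  · intro h y
    rw [isUnit_integralClosure_iff hv]
    have h1 : v ((x : Ω) * y) < v 1 := by
      rw [map_mul, map_one]
      exact mul_lt_one_of_nonneg_of_lt_one_left (v.nonneg _) h (map_coe_le_one hv y)
    have := hna.add_eq_right_of_lt h1
    rw [map_one] at this
    exact this

lemma isMaximal_jacobson_bot :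
    (Ideal.jacobson (⊥ : Ideal (integralClosure 𝒪[K] Ω))).IsMaximal := by
  rw [Ideal.isMaximal_iff]
  refine ⟨fun h => ?_, fun J x hJ hx hxJ => ?_⟩
  · rw [mem_jacobson_bot_iff hv hna] at h
    exact absurd h (by simp)
  · rw [mem_jacobson_bot_iff hv hna, not_lt] at hx
    have := (isUnit_integralClosure_iff hv x).2 (le_antisymm (map_coe_le_one hv x) hx)
    rw [Ideal.eq_top_of_isUnit_mem _ hxJ this]
    trivial

end

end IsNonarchimedeanLocalField

section

variable (K : Type*) [Field K] [ValuativeRel K] [TopologicalSpace K]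
  [IsNonarchimedeanLocalField K]

open ValuativeRel in
/-- The extension of the absolute value of a local field to an algebraic extension. -/
lemma IsNonarchimedeanLocalField.exists_absoluteValue (Ω : Type*) [Field Ω] [Algebra K Ω]
    [Algebra.IsAlgebraic K Ω] :
    ∃ v : AbsoluteValue Ω ℝ, IsNonarchimedean v ∧ (∀ (g : Ω ≃ₐ[K] Ω) (x : Ω), v (g x) = v x) ∧
      (∀ x : Ω, v x ≤ 1 ↔ IsIntegral 𝒪[K] x) := by
  let := IsTopologicalAddGroup.rightUniformSpace K
  have := isUniformAddGroup_of_addCommGroup (G := K)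
  let : (Valued.v (R := K)).RankOne :=
  { hom' := IsRankLeOne.nonempty.some.emb (R := K).comp MonoidWithZeroHom.ValueGroup₀.embedding
    strictMono' := IsRankLeOne.nonempty.some.strictMono.comp
        MonoidWithZeroHom.ValueGroup₀.embedding_strictMono }
  have : CompleteSpace K := inferInstance
  let : NontriviallyNormedField K := Valued.toNontriviallyNormedField K (ValueGroupWithZero K)
  have : IsUltrametricDist K := Valued.instIsUltrametricDist K (ValueGroupWithZero K)
  have hK : ∀ x : K, ‖x‖ ≤ 1 ↔ x ∈ 𝒪[K] := fun x =>
    Valued.toNormedField.norm_le_one_iff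
  refine ⟨⟨⟨spectralNorm K Ω, map_mul (spectralMulAlgNorm K Ω)⟩, spectralNorm_nonneg, fun x =>
    ⟨fun hx => eq_zero_of_map_spectralNorm_eq_zero hx (Algebra.IsAlgebraic.isAlgebraic x), ?_⟩,
    map_add_le_add (spectralMulAlgNorm K Ω)⟩, isNonarchimedean_spectralNorm,
    fun g x => (spectralNorm_eq_of_equiv g x).symm, fun x => ?_⟩
  · rintro rfl; exact spectralNorm_zero
  · have hx : IsIntegral K x := Algebra.IsIntegral.isIntegral x
    change spectralValue (minpoly K x) ≤ 1 ↔ _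
    rw [spectralValue_le_one_iff (minpoly.monic hx)]
    -- The spectral norm is at most 1 exactly when the minimal polynomial over K has coefficients in
    -- 𝒪[K], which is integrality because 𝒪[K] is integrally closed.
    simp only [hK]
    constructor
    · intro h
      have hmem : (↑(minpoly K x).coeffs : Set K) ⊆ 𝒪[K] := by
        intro a ha
        obtain ⟨n, -, rfl⟩ := Polynomial.mem_coeffs_iff.1 ha
        exact h n
      refine ⟨(minpoly K x).toSubring 𝒪[K] hmem, ?_, ?_⟩
      · rw [Polynomial.monic_toSubring]; exact minpoly.monic hx
      · have : ((minpoly K x).toSubring 𝒪[K] hmem).map (algebraMap 𝒪[K] K) = minpoly K x :=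
          Polynomial.map_toSubring _ _ _
        rw [IsScalarTower.algebraMap_eq 𝒪[K] K Ω, ← Polynomial.eval₂_map, this]
        exact minpoly.aeval K x
    · intro h n
      rw [minpoly.isIntegrallyClosed_eq_field_fractions' K h, Polynomial.coeff_map]
      exact ((minpoly 𝒪[K] x).coeff n).2


namespace IsNonarchimedeanLocalField

variable {K} {Ω : Type*} [Field Ω] [Algebra K Ω] {v : AbsoluteValue Ω ℝ}

section

variable (hna : IsNonarchimedean v) (hv : ∀ x : Ω, v x ≤ 1 ↔ IsIntegral 𝒪[K] x)
include hv

lemma map_algebraMap_lt_one {x : 𝒪[K]} : v (algebraMap K Ω x) < 1 ↔ x ∈ 𝓂[K] := by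
  rw [IsLocalRing.mem_maximalIdeal, mem_nonunits_iff]
  constructor
  · rintro h ⟨u, rfl⟩
    exact h.ne (map_algebraMap_unit hv u)
  · intro h
    refine lt_of_le_of_ne (map_algebraMap_le_one hv x) fun h1 => h ?_
    have hx0 : (x : K) ≠ 0 := by intro h0; rw [h0] at h1; simp at h1
    have hint : IsIntegral 𝒪[K] ((x : K)⁻¹) := by
      rw [← isIntegral_algebraMap_iff (algebraMap K Ω).injective (A := K) (R := 𝒪[K]), ← hv,
        map_inv₀, map_inv₀, h1, inv_one]
    obtain ⟨y, hy⟩ := IsIntegrallyClosed.isIntegral_iff.1 hint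
    refine IsUnit.of_mul_eq_one y ?_
    ext
    have hy' : (y : K) = (x : K)⁻¹ := hy
    simp [hy', hx0]

lemma exists_uniformizer : ∃ π : K, 0 < v (algebraMap K Ω π) ∧ v (algebraMap K Ω π) < 1 ∧
    ∀ x : K, x ≠ 0 → ∃ m : ℤ, v (algebraMap K Ω x) = v (algebraMap K Ω π) ^ m := by
  obtain ⟨π, hπ⟩ := IsDiscreteValuationRing.exists_irreducible 𝒪[K]
  refine ⟨π, v.pos (by simpa using hπ.ne_zero), ?_, fun x hx => ?_⟩
  · rw [map_algebraMap_lt_one hv, IsLocalRing.mem_maximalIdeal]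
    exact hπ.not_isUnit
  · obtain ⟨m, u, rfl⟩ :=
      IsDiscreteValuationRing.exists_units_eq_smul_zpow_of_irreducible hπ hx
    refine ⟨m, ?_⟩
    have : u • (algebraMap 𝒪[K] K π) ^ m = (u : 𝒪[K]) * (π : K) ^ m := by
      rw [Units.smul_def, Algebra.smul_def]; rfl
    rw [this, map_mul, map_mul, map_algebraMap_unit hv, one_mul, map_zpow₀, map_zpow₀]

include hna

lemma liesOver_jacobson_bot :
    (Ideal.jacobson (⊥ : Ideal (integralClosure 𝒪[K] Ω))).LiesOver 𝓂[K] := by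
  constructor
  ext x
  rw [Ideal.under_def, Ideal.mem_comap, mem_jacobson_bot_iff hv hna, ← map_algebraMap_lt_one hv]
  rfl

end

instance isInvariant_integralClosure [IsGalois K Ω] :
    Algebra.IsInvariant 𝒪[K] (integralClosure 𝒪[K] Ω) (Ω ≃ₐ[K] Ω) where
  isInvariant b hb := by
    obtain ⟨a, ha⟩ : (b : Ω) ∈ Set.range (algebraMap K Ω) := by
      rw [InfiniteGalois.mem_range_algebraMap_iff_fixed]
      intro g
      exact congrArg Subtype.val (hb g)
    have hint : IsIntegral 𝒪[K] a := by
      rw [← isIntegral_algebraMap_iff (algebraMap K Ω).injective (A := K) (R := 𝒪[K]), ha]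
      exact b.2
    obtain ⟨y, rfl⟩ := IsIntegrallyClosed.isIntegral_iff.1 hint
    exact ⟨y, Subtype.ext ha⟩

end IsNonarchimedeanLocalField

/-! ### Residue field extensions and lifting Frobenius -/

section FiniteField

variable {k L : Type*} [Field k] [Finite k] [Field L] [Algebra k L] [Algebra.IsAlgebraic k L]

/-- The finite subfield k(x) is normal, with automorphism group generated by Frobenius; the exponent
may depend on x. -/
lemma FiniteField.exists_algEquiv_apply_eq_pow (σ : L ≃ₐ[k] L) (x : L) :
    ∃ j : ℕ, σ x = x ^ Nat.card k ^ j := by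
  classical
  have := Fintype.ofFinite k
  let E := IntermediateField.adjoin k {x}
  have : FiniteDimensional k E := IntermediateField.adjoin.finiteDimensional
    (Algebra.IsIntegral.isIntegral x)
  have : Finite E := Module.finite_of_finite k
  obtain ⟨j, hj⟩ := (FiniteField.bijective_frobeniusAlgEquivOfAlgebraic_pow k E).2
    (σ.restrictNormal E)
  refine ⟨j, ?_⟩
  have h1 := σ.restrictNormal_commutes E ⟨x, IntermediateField.mem_adjoin_simple_self k x⟩
  rw [← hj] at h1
  have h2 : (FiniteField.frobeniusAlgEquivOfAlgebraic k E ^ (j : ℕ))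
      ⟨x, IntermediateField.mem_adjoin_simple_self k x⟩ =
      (⟨x, IntermediateField.mem_adjoin_simple_self k x⟩ : E) ^ Fintype.card k ^ (j : ℕ) := by
    rw [AlgEquiv.coe_pow, FiniteField.coe_frobeniusAlgEquivOfAlgebraic_iterate]
  rw [h2, map_pow] at h1
  rw [Nat.card_eq_fintype_card]
  exact h1.symm

variable (k) in
lemma FiniteField.exists_pow_eq_one {x : L} (hx : x ≠ 0) :
    ∃ m : ℕ, m ≠ 0 ∧ x ^ (Nat.card k ^ m - 1) = 1 := by
  classical
  have := Fintype.ofFinite k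
  let E := IntermediateField.adjoin k {x}
  have : FiniteDimensional k E := IntermediateField.adjoin.finiteDimensional
    (Algebra.IsIntegral.isIntegral x)
  have : Finite E := Module.finite_of_finite k
  have := Fintype.ofFinite E
  refine ⟨Module.finrank k E, Module.finrank_pos.ne', ?_⟩
  have h1 := FiniteField.pow_card_sub_one_eq_one
    (⟨x, IntermediateField.mem_adjoin_simple_self k x⟩ : E) (by simpa [Subtype.ext_iff] using hx)
  rw [Module.card_eq_pow_finrank (K := k)] at h1
  rw [Nat.card_eq_fintype_card]
  exact congrArg Subtype.val h1

end FiniteField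

end

section ResidueField

open scoped Pointwise

variable {A B G : Type*} [CommRing A] [CommRing B] [Algebra A B] (P : Ideal A) (Q : Ideal B)
  [P.IsMaximal] [Q.IsMaximal] [Q.LiesOver P] [Finite (A ⧸ P)]

include P in
lemma Ideal.natCast_notMem_of_coprime {n : ℕ} (hn : n.Coprime (Nat.card (A ⧸ P))) :
    (n : B) ∉ Q := by
  let : Field (A ⧸ P) := Ideal.Quotient.field _
  let : Field (B ⧸ Q) := Ideal.Quotient.field _
  have := Fintype.ofFinite (A ⧸ P)
  intro hmem
  have hcard : ((Nat.card (A ⧸ P) : ℕ) : B ⧸ Q) = 0 := by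
    rw [Nat.card_eq_fintype_card, ← map_natCast (algebraMap (A ⧸ P) (B ⧸ Q)),
      FiniteField.cast_card_eq_zero, map_zero]
  have hn0 : (n : B ⧸ Q) = 0 := by
    rw [← map_natCast (Ideal.Quotient.mk Q)]
    exact Ideal.Quotient.eq_zero_iff_mem.2 hmem
  have hb := congrArg (Int.cast : ℤ → B ⧸ Q) (Nat.gcd_eq_gcd_ab n (Nat.card (A ⧸ P)))
  rw [hn] at hb
  push_cast at hb
  rw [hn0, hcard] at hb
  simp at hb

variable [Algebra.IsIntegral A B]

lemma Ideal.exists_pow_sub_one_mem {x : B} (hx : x ∉ Q) :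
    ∃ m : ℕ, m ≠ 0 ∧ x ^ (Nat.card (A ⧸ P) ^ m - 1) - 1 ∈ Q := by
  let : Field (A ⧸ P) := Ideal.Quotient.field _
  let : Field (B ⧸ Q) := Ideal.Quotient.field _
  have : Algebra.IsIntegral (A ⧸ P) (B ⧸ Q) := inferInstance
  have : Algebra.IsAlgebraic (A ⧸ P) (B ⧸ Q) := Algebra.IsIntegral.isAlgebraic
  obtain ⟨m, hm, hpow⟩ := FiniteField.exists_pow_eq_one (A ⧸ P) (x := Ideal.Quotient.mk Q x)
    (by rwa [Ne, Ideal.Quotient.eq_zero_iff_mem])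
  refine ⟨m, hm, ?_⟩
  rwa [← Ideal.Quotient.mk_eq_mk_iff_sub_mem, map_pow, map_one]

variable [Group G] [MulSemiringAction G B] [SMulCommClass G A B]

include P in
lemma Ideal.exists_smul_sub_pow_mem {g : G} (hg : g • Q = Q) (x : B) :
    ∃ j : ℕ, g • x - x ^ Nat.card (A ⧸ P) ^ j ∈ Q := by
  let : Field (A ⧸ P) := Ideal.Quotient.field _
  let : Field (B ⧸ Q) := Ideal.Quotient.field _
  have : Algebra.IsIntegral (A ⧸ P) (B ⧸ Q) := inferInstance
  have : Algebra.IsAlgebraic (A ⧸ P) (B ⧸ Q) := Algebra.IsIntegral.isAlgebraic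
  obtain ⟨j, hj⟩ := FiniteField.exists_algEquiv_apply_eq_pow
    (Ideal.Quotient.stabilizerHom Q P G ⟨g, hg⟩) (Ideal.Quotient.mk Q x)
  refine ⟨j, ?_⟩
  rw [← Ideal.Quotient.mk_eq_mk_iff_sub_mem, map_pow]
  exact hj

variable [TopologicalSpace G] [CompactSpace G] [TotallyDisconnectedSpace G]
  [IsTopologicalGroup G] [TopologicalSpace B] [DiscreteTopology B] [ContinuousSMul G B]
  [Algebra.IsInvariant A B G]

-- A Frobenius on the residue field lifts because the decomposition group of a profinite group
-- surjects onto residual automorphisms.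
include P in
variable (G) in
lemma Ideal.exists_forall_smul_sub_pow_card_mem :
    ∃ g : G, ∀ x : B, g • x - x ^ Nat.card (A ⧸ P) ∈ Q := by
  let : Field (A ⧸ P) := Ideal.Quotient.field _
  let : Field (B ⧸ Q) := Ideal.Quotient.field _
  have : Algebra.IsIntegral (A ⧸ P) (B ⧸ Q) := inferInstance
  have : Algebra.IsAlgebraic (A ⧸ P) (B ⧸ Q) := Algebra.IsIntegral.isAlgebraic
  have := Fintype.ofFinite (A ⧸ P)
  obtain ⟨⟨g, hg⟩, hgσ⟩ := Ideal.Quotient.stabilizerHom_surjective_of_profinite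
    (G := G) P Q (FiniteField.frobeniusAlgEquivOfAlgebraic (A ⧸ P) (B ⧸ Q))
  refine ⟨g, fun x => ?_⟩
  have h1 := DFunLike.congr_fun hgσ (Ideal.Quotient.mk Q x)
  rw [FiniteField.coe_frobeniusAlgEquivOfAlgebraic] at h1
  rw [← Ideal.Quotient.mk_eq_mk_iff_sub_mem, map_pow, Nat.card_eq_fintype_card]
  exact h1

end ResidueField

/-! ### Verification of the tame axioms -/

namespace IsNonarchimedeanLocalField

variable {K : Type*} [Field K] [ValuativeRel K] [TopologicalSpace K]
  [IsNonarchimedeanLocalField K] {Ω : Type*} [Field Ω] [Algebra K Ω] {v : AbsoluteValue Ω ℝ}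

open scoped Pointwise in
/-- The spectral norm on a Galois extension of a local field is tame. -/
theorem isTameValuation [IsGalois K Ω] (hna : IsNonarchimedean v)
    (hinv : ∀ (g : Ω ≃ₐ[K] Ω) (x : Ω), v (g x) = v x)
    (hv : ∀ x : Ω, v x ≤ 1 ↔ IsIntegral 𝒪[K] x) : IsTameValuation K v (Nat.card 𝓀[K]) := by
  let Q : Ideal (integralClosure 𝒪[K] Ω) := Ideal.jacobson ⊥
  have hQ : ∀ x : integralClosure 𝒪[K] Ω, x ∈ Q ↔ v x < 1 := mem_jacobson_bot_iff hv hna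
  have : Q.IsMaximal := isMaximal_jacobson_bot hv hna
  have : Q.LiesOver 𝓂[K] := liesOver_jacobson_bot hna hv
  have : Finite (𝒪[K] ⧸ 𝓂[K]) := inferInstanceAs (Finite 𝓀[K])
  -- The discrete topology makes the Galois action continuous, since stabilizers are open, as
  -- lifting Frobenius requires.
  let : TopologicalSpace (integralClosure 𝒪[K] Ω) := ⊥
  have : DiscreteTopology (integralClosure 𝒪[K] Ω) := ⟨rfl⟩
  have : ContinuousSMul (Ω ≃ₐ[K] Ω) (integralClosure 𝒪[K] Ω) := by
    rw [continuousSMul_iff_stabilizer_isOpen]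
    intro x
    refine Subgroup.isOpen_mono (fun g hg => ?_) (IsTameValuation.isOpen_stabilizer (K := K) (x : Ω))
    exact Subtype.ext hg
  have hstab : ∀ g : Ω ≃ₐ[K] Ω, g • Q = Q := fun g => by
    ext x
    rw [Ideal.mem_pointwise_smul_iff_inv_smul_mem, hQ, hQ, integralClosure.coe_smul,
      AlgEquiv.smul_def, hinv]
  have hcard : Nat.card 𝓀[K] = Nat.card (𝒪[K] ⧸ 𝓂[K]) := rfl
  refine ⟨hna, hinv, exists_uniformizer hv, Finite.one_lt_card, fun n hn => ?_, ?_,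
    fun g x hx => ?_, fun x hx => ?_⟩
  · have h1 : v (n : Ω) ≤ 1 := (hv _).2 (by
      rw [← map_natCast (algebraMap 𝒪[K] Ω)]; exact isIntegral_algebraMap)
    refine le_antisymm h1 (not_lt.1 fun hlt => ?_)
    exact Ideal.natCast_notMem_of_coprime 𝓂[K] Q hn ((hQ _).2 (by simpa using hlt))
  · obtain ⟨F, hF⟩ := Ideal.exists_forall_smul_sub_pow_card_mem (Ω ≃ₐ[K] Ω) 𝓂[K] Q
    exact ⟨F, fun x hx => (hQ _).1 (hF ⟨x, (hv x).1 hx⟩)⟩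
  · obtain ⟨j, hj⟩ := Ideal.exists_smul_sub_pow_mem 𝓂[K] Q (hstab g) ⟨x, (hv x).1 hx⟩
    exact ⟨j, (hQ _).1 hj⟩
  · obtain ⟨m, hm, hpow⟩ := Ideal.exists_pow_sub_one_mem 𝓂[K] Q (x := ⟨x, (hv x).1 hx.le⟩)
      (by rw [hQ]; exact hx.not_lt)
    refine ⟨Nat.card 𝓀[K] ^ m - 1, ?_, (hQ _).1 hpow⟩
    have h1 : 1 ≤ Nat.card 𝓀[K] ^ m := Nat.one_le_pow _ _ Nat.card_pos
    exact ((Nat.coprime_self_sub_left h1 (n := Nat.card 𝓀[K] ^ m)).2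
      (by simp)).coprime_dvd_right (dvd_pow_self _ hm)

end IsNonarchimedeanLocalField

/-! ### Local fields and the mass formula -/

namespace LocalField

variable (K : LocalField.{u})

/-- The structure of the tame Galois group: for `q` prime to `|Γ|`, continuous homomorphisms
`G_K → Γ` correspond to pairs `(s, t)` with `s t s⁻¹ = t ^ q`, and `t` generates the image of
inertia. -/
theorem exists_rep_equiv {Γ : Type v} [Group Γ] [Finite Γ] [TopologicalSpace Γ]
    [DiscreteTopology Γ] (hn : K.q.Coprime (Nat.card Γ)) :
    ∃ e : K.Rep Γ ≃ {p : Γ × Γ // p.1 * p.2 * p.1⁻¹ = p.2 ^ K.q},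
      ∀ ρ : K.Rep Γ, K.inertia.map ρ.toMonoidHom = Subgroup.zpowers (e ρ).1.2 := by
  obtain ⟨v, hna, hinv, hv⟩ := IsNonarchimedeanLocalField.exists_absoluteValue K K.Sep
  have h := IsNonarchimedeanLocalField.isTameValuation hna hinv hv
  have hI : K.inertia = h.inertia := by
    ext g
    rw [h.mem_inertia]
    constructor
    · intro hg x hx
      exact (IsNonarchimedeanLocalField.mem_jacobson_bot_iff hv hna _).1 (hg ⟨x, (hv x).1 hx⟩)
    · intro hg x
      exact (IsNonarchimedeanLocalField.mem_jacobson_bot_iff hv hna _).2 (hg x ((hv x).2 x.2))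
  rw [hI]
  exact h.exists_equiv_pairs hn.symm

end LocalField

namespace CountingFunction

variable {Γ : Type v} [Group Γ] [TopologicalSpace Γ]

lemma totalMass_eq_of_equiv (c : CountingFunction.{u, v} Γ) (K : LocalField.{u}) {ι : Type*}
    [Fintype ι] (e : ι ≃ K.Rep Γ) (hq : K.q ≠ 0) :
    c.totalMass K ≠ ∞ ∧
      (c.totalMass K).toReal = ∑ i, (1 / (K.q : ℝ)) ^ c K (e i) := by
  have hterm : ∀ n : ℕ, ((K.q : ℝ≥0∞) ^ n)⁻¹ ≠ ∞ := fun n => by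
    simp [hq]
  rw [totalMass, ← e.tsum_eq, tsum_fintype]
  refine ⟨ENNReal.sum_ne_top.2 fun i _ => hterm _, ?_⟩
  rw [ENNReal.toReal_sum fun i _ => hterm _]
  exact Finset.sum_congr rfl fun i _ => by simp

end CountingFunction

theorem mainTheorem5 {Γ : Type v} [Group Γ] [Finite Γ] [TopologicalSpace Γ] [DiscreteTopology Γ]
    (c : CountingFunction.{u, v} Γ) (hc : c.IsProper) (a : ZMod (Nat.card Γ)) (ha : IsUnit a) :
    c.HasMassFormula {K : LocalField.{u} | (K.q : ZMod (Nat.card Γ)) = a} := by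
  rcases Set.eq_empty_or_nonempty {K : LocalField.{u} | (K.q : ZMod (Nat.card Γ)) = a} with
    hempty | ⟨K₀, hK₀⟩
  · exact ⟨0, fun K hK => by rw [hempty] at hK; exact hK.elim⟩
  have hcop : ∀ K : LocalField.{u}, (K.q : ZMod (Nat.card Γ)) = a → K.q.Coprime (Nat.card Γ) :=
    fun K hK => (ZMod.isUnit_iff_coprime _ _).1 (hK ▸ ha)
  obtain ⟨e₀, he₀⟩ := K₀.exists_rep_equiv (hcop K₀ hK₀)
  have : Finite (K₀.Rep Γ) := Finite.of_equiv _ e₀.symm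
  have := Fintype.ofFinite (K₀.Rep Γ)
  -- The polynomial is read off from one reference field `K₀` of the class.
  refine ⟨∑ ρ : K₀.Rep Γ, Polynomial.X ^ c K₀ ρ, fun K hK => ?_⟩
  obtain ⟨e, he⟩ := K.exists_rep_equiv (hcop K hK)
  have hpow : ∀ t : Γ, t ^ K.q = t ^ K₀.q := fun t =>
    pow_eq_pow_iff_modEq.2 (((ZMod.natCast_eq_natCast_iff _ _ _).1
      (Eq.trans hK (Eq.symm hK₀))).of_dvd (orderOf_dvd_natCard t))
  -- The bijection keeps the pair (s, t), hence the inertia image generated by t, so properness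
  -- gives equal values of c.
  let E : K₀.Rep Γ ≃ K.Rep Γ := e₀.trans <|
    (Equiv.subtypeEquivRight fun p => by rw [hpow]).trans e.symm
  have hE : ∀ ρ, c K (E ρ) = c K₀ ρ := fun ρ =>
    hc K K₀ _ _ (hcop K hK) (hcop K₀ hK₀) (by rw [he, he₀]; simp [E])
  have hq : K.q ≠ 0 := by
    have : Finite 𝓀[K] := inferInstance
    exact Nat.card_pos.ne'
  obtain ⟨h1, h2⟩ := c.totalMass_eq_of_equiv K E hq
  refine ⟨h1, ?_⟩
  rw [h2, map_sum]
  exact Finset.sum_congr rfl fun ρ _ => by rw [hE, map_pow, Polynomial.aeval_X]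

end
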